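/- **Setting.** Let $N,T\ge 1$ be integers. For $n\in\{1,\dots,N\}$ we observe $y_n(t)=f_n(t)+x_n(t)$, $t=1,\dots,T$, where $f_n$ is deterministic and $x_n$ is a (weakly) stationary $\mathrm{AR}(p_n)$ process, $p_n\ge 1$: for all $t\in\mathbb Z$, $x_n(t)=\sum_{i=1}^{p_n}\alpha_{ni}x_n(t-i)+\eta_n(t)$. Let $\alpha_n=(\alpha_{n1},\dots,\alpha_{np_n})$. The roots $\lambda_{n1},\dots,\lambda_{np_n}\in\mathbb C$ of $z^{p_n}-\sum_i\alpha_{ni}z^{p_n-i}$ are distinct and lie in the open unit disc. The noise variables $\eta_n(t)$ (over all $n$ and all $t\in\mathbb Z$) are i.i.d. with mean $0$, variance $\sigma^2>0$, and sub-gaussian with variance proxy $\kappa\sigma^2$, i.e. $\mathbb E e^{s\eta_n(t)}\le e^{\kappa\sigma^2s^2/2}$ for all $s\in\mathbb R$, where $\kappa\ge1$. Let $A_n$ be the companion matrix with first row $\alpha_n^\top$ and ones on the subdiagonal, $B_n=(1,0,\dots,0)^\top\in\mathbb R^{p_n}$, $\Psi_n=\sum_{t\ge0}A_n^tB_nB_n^\top(A_n^\top)^t$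 and $\Gamma_n=\sum_{t\ge0}A_n^t(A_n^\top)^t$. Write $\lambda_{\min}(\Psi)=\min_n\lambda_{\min}(\Psi_n)$, $\lambda_{\max}(\Psi)=\max_n\lambda_{\max}(\Psi_n)$, $\lambda_{\max}(\Gamma)=\max_n\lambda_{\max}(\Gamma_n)$, $p=\max_np_n$, $\alpha_{\max}=\max_n\|\alpha_n\|_2$, $\lambda_\star=\max_{n,i}|\lambda_{ni}|$, $c_\lambda=\max_n\sum_i\prod_{j\ne i}\left|\frac{\lambda_{ni}}{\lambda_{ni}-\lambda_{nj}}\right|$ and $\sigma_x=\frac{c_\lambda\sigma}{1-\lambda_\star}$. For estimates $\widehat f_n(t)$ of $f_n(t)$, $t=1,\dots,T$, let $\mathsf{EstErr}(N,T,n)=\frac1T\sum_{t=1}^T(\widehat f_n(t)-f_n(t))^2$ and $\widehat x_n=y_n-\widehat f_n$, and let $\widehat\alpha_n$ be any minimizer over $a\in\mathbb R^{p_n}$ of $\sum_{t=p_n}^{T-1}\bigl(\widehat x_n(t+1)-\sum_{i=1}^{p_n}a_i\,\widehat x_n(t-i+1)\bigr)^2$. **Theorem.** For every $\kappa\ge1$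 there are constants $c,C_0,C>0$, depending only on $\kappa$, such that the following holds in the above setting whenever $$\frac{\log T}{\sqrt T}<\frac{C_0\,\sigma^2}{p\,\sigma_x^2\max\{1,\alpha_{\max}^2\}}\cdot\frac{\lambda_{\min}(\Psi)}{\lambda_{\max}(\Gamma)} .$$ (a) Suppose that $N\le T$, that $L=\sqrt{NT}$ is an integer dividing $T$, and that, for some integers $R,G\ge 0$ and some $\gamma>0$: - $f_n=\sum_{r=1}^Ru_{nr}w_r$ for all $n$, with $u_{nr}\in\mathbb R$ and $w_r:\{1,2,\dots\}\to\mathbb R$ such that for all $T'>1$, $1\le L'\le T'$, $t_0>0$ the Page matrix $\bigl(w_r(t_0+i-1+(j-1)L')\bigr)_{i\le L',\,j\le\lfloor T'/L'\rfloor}$ has rank at most $G$; - for every $t_0>0$, the $L\times NT/L$ stacked Page matrix $\mathbf Z_f(t_0)$, i.e. the side-by-side concatenation over $n$ of the matrices $\bigl(f_n(t_0+i-1+(j-1)L)\bigr)_{i\le L,\,j\le T/L}$, has $\sigma_k(\mathbf Z_f(t_0))\ge\gamma\sqrt{NT}/\sqrt k$ with $k=\operatorname{rank}\mathbf Z_f(t_0)$,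 if $k\ge1$. Let $\widehat f_1,\dots,\widehat f_N$ be the series whose stacked Page matrix (at $t_0=1$) consists of the top $\operatorname{rank}\mathbf Z_f(1)$ components of a singular value decomposition of the stacked Page matrix of $y_1,\dots,y_N$. Then for every $n$, with probability at least $1-c/T^{10}$: if $\mathsf{EstErr}(N,T,n)\le\frac{\sigma^2\lambda_{\min}(\Psi)}{6p}$, then $$\|\widehat\alpha_n-\alpha_n\|_2^2\le\frac{C\,p}{\lambda_{\min}(\Psi)}\left(\frac pT\log\left(\frac{T\lambda_{\max}(\Psi)}{\lambda_{\min}(\Psi)}\right)+\frac{\sigma_x^2\,\mathsf{EstErr}(N,T,n)\log T}{\sigma^2\min\{1,\sigma^2\lambda_{\min}(\Psi)\}}\right).$$ (b) The same holds under arbitrary bounded perturbations: without the assumptions of (a), for every $n$ there is an event of probability at least $1-c/T^{10}$ on which the above bound holds for all real sequences $\widehat f_n(1),\dots,\widehat f_n(T)$ with $\mathsf{EstErr}(N,T,n)\le\frac{\sigma^2\lambda_{\min}(\Psi)}{6p}$ and every corresponding $\widehat\alpha_n$. -/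

import Mathlib

open MeasureTheory ProbabilityTheory Polynomial
open scoped NNReal

namespace Samossa

noncomputable section

/-! ### Autoregressive models -/

/-- The characteristic polynomial `g(z) = z ^ p - ∑ i, α_i z ^ (p - i)` of an `AR(p)` recursion.
Coefficients are indexed from `0`, so that `α i` multiplies the lag `i + 1`. -/
def charPoly {p : ℕ} (α : EuclideanSpace ℝ (Fin p)) : ℂ[X] :=
  X ^ p - ∑ i : Fin p, C ((α i : ℝ) : ℂ) * X ^ (p - 1 - (i : ℕ))

/-- The set of complex roots of the characteristic polynomial. -/
def charRoots {p : ℕ} (α : EuclideanSpace ℝ (Fin p)) : Finset ℂ :=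
  (charPoly α).roots.toFinset

/-- The largest modulus of a characteristic root. -/
def rootRadius {p : ℕ} (α : EuclideanSpace ℝ (Fin p)) : ℝ≥0 :=
  (charRoots α).sup fun z => ‖z‖₊

/-- `∑_i |∏_{j ≠ i} (1 - λ_j / λ_i)⁻¹|`, where each factor is written as `λ_i / (λ_i - λ_j)`, so that
it is also meaningful when one of the roots is zero. -/
def rootConst {p : ℕ} (α : EuclideanSpace ℝ (Fin p)) : ℝ :=
  ∑ z ∈ charRoots α, ‖∏ w ∈ (charRoots α).erase z, z / (z - w)‖

/-- The transition (companion) matrix: first row `α`, ones on the subdiagonal. -/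
def companion {p : ℕ} (α : EuclideanSpace ℝ (Fin p)) : Matrix (Fin p) (Fin p) ℝ :=
  Matrix.of fun i j => if (i : ℕ) = 0 then α j else if (i : ℕ) = (j : ℕ) + 1 then 1 else 0

/-- The input vector `(1, 0, …, 0)`. -/
def inputVec (p : ℕ) : Fin p → ℝ := fun i => if (i : ℕ) = 0 then 1 else 0

/-- The controllability Gramian `Ψ = ∑ t, A ^ t B Bᵀ (Aᵀ) ^ t`. -/
def gramPsi {p : ℕ} (α : EuclideanSpace ℝ (Fin p)) : Matrix (Fin p) (Fin p) ℝ :=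
  ∑' t : ℕ, companion α ^ t * Matrix.vecMulVec (inputVec p) (inputVec p) *
    (companion α).transpose ^ t

/-- The matrix `Γ = ∑ t, A ^ t (Aᵀ) ^ t`. -/
def gramGamma {p : ℕ} (α : EuclideanSpace ℝ (Fin p)) : Matrix (Fin p) (Fin p) ℝ :=
  ∑' t : ℕ, companion α ^ t * (companion α).transpose ^ t

/-- The smallest eigenvalue of a symmetric matrix of positive size (there the spectrum is a
nonempty finite set of reals). -/
def lamMin {p : ℕ} (M : Matrix (Fin p) (Fin p) ℝ) : ℝ := sInf (spectrum ℝ M)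

/-- The largest eigenvalue of a symmetric matrix of positive size. -/
def lamMax {p : ℕ} (M : Matrix (Fin p) (Fin p) ℝ) : ℝ := sSup (spectrum ℝ M)

/-- The parameters of `N` autoregressive processes, the `n`-th one of order `p n ≥ 1`. -/
structure ARFamily (N : ℕ) where
  /-- the orders -/
  p : Fin N → ℕ
  p_pos : ∀ n, 0 < p n
  /-- the coefficients; `α n i` multiplies the lag `i + 1` -/
  α : (n : Fin N) → EuclideanSpace ℝ (Fin (p n))

namespace ARFamily

variable {N : ℕ} (M : ARFamily N)

/-- All characteristic roots lie in the open unit disc, and for each `n` they are distinct. -/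
def Stable : Prop :=
  ∀ n, (∀ z ∈ (charPoly (M.α n)).roots, ‖z‖ < 1) ∧ (charPoly (M.α n)).roots.Nodup

/-- `p = max_n p_n`. -/
def pMax : ℕ := Finset.univ.sup M.p

/-- `α_max = max_n ‖α_n‖₂`. -/
def alphaMax : ℝ := ⨆ n, ‖M.α n‖

/-- `λ_⋆ = max_{i, n} |λ_{ni}|`. -/
def lamStar : ℝ := ((Finset.univ.sup fun n => rootRadius (M.α n) : ℝ≥0) : ℝ)

/-- `c_λ = max_n ∑_i |∏_{j ≠ i} (1 - λ_{nj} / λ_{ni})⁻¹|`. -/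
def cLam : ℝ := ⨆ n, rootConst (M.α n)

/-- `σ_x = c_λ σ / (1 - λ_⋆)`. -/
def sigmaX (σ : ℝ) : ℝ := M.cLam * σ / (1 - M.lamStar)

/-- `λ_min(Ψ) = min_n λ_min(Ψ_n)`. -/
def psiMin : ℝ := ⨅ n, lamMin (gramPsi (M.α n))

/-- `λ_max(Ψ) = max_n λ_max(Ψ_n)`. -/
def psiMax : ℝ := ⨆ n, lamMax (gramPsi (M.α n))

/-- `λ_max(Γ) = max_n λ_max(Γ_n)`. -/
def gammaMax : ℝ := ⨆ n, lamMax (gramGamma (M.α n))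

/-- The requirement that the horizon `T` be large. -/
def LargeHorizon (σ C₀ : ℝ) (T : ℕ) : Prop :=
  Real.log T / Real.sqrt T <
    C₀ * σ ^ 2 / (M.pMax * M.sigmaX σ ^ 2 * max 1 (M.alphaMax ^ 2)) * (M.psiMin / M.gammaMax)

/-- The admissible level of the estimation error, `σ² λ_min(Ψ) / (6 p)`. -/
def errLevel (σ : ℝ) : ℝ := σ ^ 2 * M.psiMin / (6 * M.pMax)

/-- The upper bound for the squared error of the coefficient estimates when the estimation error of
the non-stationary component is `E`. -/
def identBound (σ C : ℝ) (T : ℕ) (E : ℝ) : ℝ :=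
  C * M.pMax / M.psiMin *
    (M.pMax / T * Real.log (T * M.psiMax / M.psiMin) +
      M.sigmaX σ ^ 2 * E * Real.log T / (σ ^ 2 * min 1 (σ ^ 2 * M.psiMin)))

variable {Ω : Type*} [MeasurableSpace Ω]

/-- `η` is i.i.d. noise (over all series and all times), with mean zero, variance `σ²` and
sub-gaussian with variance proxy `κ σ²`; and each `x n` is a (weakly) stationary solution, over
`ℤ`, of the autoregressive recursion driven by `η n`. -/
structure IsStationaryAR (σ κ : ℝ) (μ : Measure Ω) (η x : Fin N → ℤ → Ω → ℝ) : Prop where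
  measurable_noise : ∀ n t, Measurable (η n t)
  indep : iIndepFun (fun i : Fin N × ℤ => η i.1 i.2) μ
  identDistrib : ∀ n t m s, IdentDistrib (η n t) (η m s) μ μ
  mean_zero : ∀ n t, ∫ ω, η n t ω ∂μ = 0
  variance_eq : ∀ n t, variance (η n t) μ = σ ^ 2
  subgaussian : ∀ n t, HasSubgaussianMGF (η n t) (Real.toNNReal (κ * σ ^ 2)) μ
  memLp : ∀ n t, MemLp (x n t) 2 μ
  mean_const : ∀ n t s, ∫ ω, x n t ω ∂μ = ∫ ω, x n s ω ∂μ
  cov_shift : ∀ n t s j, covariance (x n t) (x n (t + j)) μ = covariance (x n s) (x n (s + j)) μ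
  recursion : ∀ n t, ∀ᵐ ω ∂μ,
    x n t ω = ∑ i : Fin (M.p n), M.α n i * x n (t - ((i : ℕ) + 1)) ω + η n t ω

end ARFamily

/-! ### Estimators -/

/-- The mean squared estimation error `(1 / T) ∑_{t = 1}^T (fhat t - f t)²`. -/
def estErr (T : ℕ) (fhat f : ℕ → ℝ) : ℝ :=
  1 / (T : ℝ) * ∑ t ∈ Finset.Icc 1 T, (fhat t - f t) ^ 2

/-- The least squares objective `∑_{t = p}^{T - 1} (z (t + 1) - aᵀ [z t, …, z (t - p + 1)])²`. -/
def olsLoss {p : ℕ} (T : ℕ) (z : ℕ → ℝ) (a : EuclideanSpace ℝ (Fin p)) : ℝ :=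
  ∑ t ∈ Finset.Ico p T, (z (t + 1) - ∑ i : Fin p, a i * z (t - (i : ℕ))) ^ 2

/-- `a` is an ordinary least squares estimate of the `AR(p)` coefficients, fitted on `z`. -/
def IsOLS {p : ℕ} (T : ℕ) (z : ℕ → ℝ) (a : EuclideanSpace ℝ (Fin p)) : Prop :=
  ∀ b : EuclideanSpace ℝ (Fin p), olsLoss T z a ≤ olsLoss T z b

/-- The Page matrix of the `T` entries `g t₀, …, g (t₀ + T - 1)` with `L` rows. -/
def page (g : ℕ → ℝ) (L T t₀ : ℕ) : Matrix (Fin L) (Fin (T / L)) ℝ :=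
  Matrix.of fun i j => g (t₀ + i + j * L)

/-- The stacked Page matrix: the Page matrices of the `N` series, side by side; the column `(n, j)`
is the `j`-th column of the `n`-th block. -/
def stackedPage {N : ℕ} (g : Fin N → ℕ → ℝ) (L T t₀ : ℕ) :
    Matrix (Fin L) (Fin N × Fin (T / L)) ℝ :=
  Matrix.of fun i c => page (g c.1) L T t₀ i c.2

/-- `W` retains the top `k` components of a singular value decomposition of `Z`. -/
def IsHSVT {L : ℕ} {ι : Type*} [Fintype ι] (k : ℕ) (Z W : Matrix (Fin L) ι ℝ) : Prop :=
  ∃ (s : Fin (min L (Fintype.card ι)) → ℝ)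
    (u : Fin (min L (Fintype.card ι)) → EuclideanSpace ℝ (Fin L))
    (v : Fin (min L (Fintype.card ι)) → EuclideanSpace ℝ ι),
    Antitone s ∧ (∀ l, 0 ≤ s l) ∧ Orthonormal ℝ u ∧ Orthonormal ℝ v ∧
    (∀ i j, Z i j = ∑ l, s l * u l i * v l j) ∧
    (∀ i j, W i j = ∑ l : Fin (min L (Fintype.card ι)), if (l : ℕ) < k then s l * u l i * v l j else 0)

/-- `fhat` is an estimate of the non-stationary components, on times `1, …, T`, computed from the
observations `y`: the entries of the thresholded stacked Page matrix of `y` are read off, i.e. that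
matrix is the stacked Page matrix of `fhat`. -/
def IsSamossaEstimate {N : ℕ} (L T k : ℕ) (y fhat : Fin N → ℕ → ℝ) : Prop :=
  IsHSVT k (stackedPage y L T 1) (stackedPage fhat L T 1)

/-- The assumptions on the non-stationary components and the choice of `L`: `N ≤ T`, `L = √(N T)`
(an integer dividing `T`), spatial structure, temporal structure, balanced spectra. -/
structure FactorModel {N : ℕ} (f : Fin N → ℕ → ℝ) (L T R G : ℕ) (γ : ℝ) : Prop where
  N_le_T : N ≤ T
  L_sq : L ^ 2 = N * T
  L_dvd : L ∣ T
  structured : ∃ (u : Fin N → Fin R → ℝ) (w : Fin R → ℕ → ℝ),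
    (∀ n t, 1 ≤ t → f n t = ∑ r, u n r * w r t) ∧
    (∀ r T' L' t₀, 1 < T' → 1 ≤ L' → L' ≤ T' → 0 < t₀ → (page (w r) L' T' t₀).rank ≤ G)
  gamma_pos : 0 < γ
  balanced : ∀ t₀ k : ℕ, 0 < t₀ → k = (stackedPage f L T t₀).rank → 0 < k →
    γ * Real.sqrt (N * T) / Real.sqrt k ≤
      (Matrix.toEuclideanLin (stackedPage f L T t₀)).singularValues (k - 1)

end

end Samossa

open Samossa

namespace Samossa

/-! ### The impulse response of an autoregressive recursion -/

section Impulse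

variable {p : ℕ} (α : EuclideanSpace ℝ (Fin p))

/-! The error bound follows from a deterministic perturbation inequality for least squares, applied
on an event that depends only on the noise. Write `δ = fhat - f`, so that the fit uses `x - δ`.
Since the event is fixed before `δ` is chosen, the bound holds there for all admissible `δ` at once.
Part (a) is therefore a special case of part (b), and nothing about singular value thresholding is
needed.

The stationary solution is the noise filtered by the impulse response `h k = (A ^ k) 0 0`
(`isFiltered_of_recursion`). Lagrange interpolation at the roots gives `|h k| ≤ c_λ λ_⋆ ^ k`, so the
`ℓ¹` norm of `h` is at most `H = c_λ / (1 - λ_⋆) = σ_x / σ`. The state has covariance `σ² Ψ`,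
because its components are delayed copies of `x`.

Three things happen off a set of measure `O(T ^ (-10))` (`exists_exceptional_set`). Every empirical
autocovariance is within `O(κ σ² H² √T log T)` of its mean: expanding both filters gives a signed
combination, of total weight at most `H²`, of lagged noise products. Each of these has a bounded
exponential moment at scale `1 / √T`, and convexity transfers the bound to the combination. The
horizon condition makes this error small against `T σ² λ_min(Ψ) / p`, so the Gram matrix dominates
`(T σ² / 4) Ψ`. The noise-regressor sums are controlled by an exponential supermartingale, in `p`
directions orthonormal for `Ψ`. The noise itself is at most of order `√(κ σ² log T)`.

The deterministic part is `norm_sub_sq_le_of_isOLS`: compare the loss at the estimate with the loss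
at the true `α`. The perturbation of the regressors may be correlated with the noise, so that cross
term is bounded by Cauchy-Schwarz, which costs the factor `log T` in front of the estimation error.
Finally `λ_min(Ψ) ‖α‖² ≤ H²` absorbs the dependence on `‖α‖`. -/

theorem degree_charPoly_tail_lt :
    (∑ i : Fin p, C ((α i : ℝ) : ℂ) * X ^ (p - 1 - (i : ℕ))).degree < (p : WithBot ℕ) := by
  refine mem_degreeLT.1 (Submodule.sum_mem _ fun i _ => mem_degreeLT.2 ?_)
  refine lt_of_le_of_lt (degree_C_mul_X_pow_le _ _) ?_
  have : p - 1 - (i : ℕ) < p := by have := i.2; omega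
  exact_mod_cast this

theorem natDegree_charPoly : (charPoly α).natDegree = p := by
  apply natDegree_eq_of_degree_eq_some
  rw [charPoly, degree_sub_eq_left_of_degree_lt, degree_X_pow]
  rw [degree_X_pow]; exact degree_charPoly_tail_lt α

theorem card_charRoots (h : (charPoly α).roots.Nodup) : (charRoots α).card = p := by
  rw [charRoots, Multiset.toFinset_card_of_nodup h,
    (splits_iff_card_roots.1 (IsAlgClosed.splits (charPoly α))), natDegree_charPoly]

theorem norm_le_rootRadius {z : ℂ} (hz : z ∈ charRoots α) : ‖z‖ ≤ rootRadius α := by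
  have : ‖z‖₊ ≤ rootRadius α := Finset.le_sup (f := fun z : ℂ => ‖z‖₊) hz
  exact_mod_cast this

theorem rootConst_nonneg : 0 ≤ rootConst α := Finset.sum_nonneg fun _ _ => norm_nonneg _

variable [NeZero p]

/-- The response of the recursion to a unit impulse: the upper left entries of the powers of the
companion matrix. -/
noncomputable def impulse (k : ℕ) : ℝ := (companion α ^ k) 0 0

/-- The response of the `i`-th component of the state to a unit impulse. -/
noncomputable def stateImpulse (i : Fin p) (k : ℕ) : ℝ := (companion α ^ k) i 0

theorem companion_zero_apply (j : Fin p) : companion α 0 j = α j := by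
  simp [companion]

theorem inputVec_eq_single : inputVec p = Pi.single 0 1 := by
  ext i
  simp only [inputVec, Pi.single_apply, Fin.ext_iff, Fin.val_zero]

theorem companion_pow_mulVec_inputVec (k : ℕ) (i : Fin p) :
    (companion α ^ k).mulVec (inputVec p) i = stateImpulse α i k := by
  rw [inputVec_eq_single, Matrix.mulVec_single_one]; rfl

theorem impulse_zero : impulse α 0 = 1 := by simp [impulse]

theorem stateImpulse_succ_of_pos (i : Fin p) (hi : (i : ℕ) + 1 < p) (k : ℕ) :
    stateImpulse α ⟨i + 1, hi⟩ (k + 1) = stateImpulse α i k := by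
  unfold stateImpulse
  rw [pow_succ', Matrix.mul_apply, Finset.sum_eq_single i]
  · simp [companion]
  · intro j _ hj
    have : (i : ℕ) ≠ (j : ℕ) := fun h => hj (Fin.ext h.symm)
    simp [companion, this]
  · simp

/-- The subdiagonal of ones moves the state down one place per step, so component `i` replays the
impulse response with delay `i`. -/
theorem stateImpulse_eq (i : Fin p) (k : ℕ) :
    stateImpulse α i k = if (i : ℕ) ≤ k then impulse α (k - i) else 0 := by
  obtain ⟨i, hi⟩ := i
  induction i generalizing k with
  | zero => simp [stateImpulse, impulse]
  | succ i ih =>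
    cases k with
    | zero =>
      have : (⟨i + 1, hi⟩ : Fin p) ≠ 0 := by simp [Fin.ext_iff]
      simp [stateImpulse, this]
    | succ k =>
      rw [stateImpulse_succ_of_pos α ⟨i, by omega⟩ hi k, ih]
      simp

theorem impulse_succ (k : ℕ) : impulse α (k + 1) = ∑ i, α i * stateImpulse α i k := by
  unfold impulse stateImpulse
  rw [pow_succ', Matrix.mul_apply]
  simp [companion_zero_apply]

/-- Column `j` of the companion matrix is supported on rows `0` and `j + 1`. Multiplying on the
right gives a recursion for the whole first row of the powers, which carries the remainder of the
unrolled recursion. -/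
theorem companion_pow_succ_zero (k : ℕ) (j : Fin p) :
    (companion α ^ (k + 1)) 0 j = impulse α k * α j +
      if h : (j : ℕ) + 1 < p then (companion α ^ k) 0 ⟨j + 1, h⟩ else 0 := by
  have key : ∀ i : Fin p, (companion α ^ k) 0 i * companion α i j =
      (if i = 0 then impulse α k * α j else 0) +
      (if (i : ℕ) = (j : ℕ) + 1 then (companion α ^ k) 0 i else 0) := by
    intro i
    by_cases hi : i = 0
    · subst hi; simp [companion_zero_apply, impulse]
    · simp [companion, hi]
  rw [pow_succ, Matrix.mul_apply, Finset.sum_congr rfl fun i _ => key i, Finset.sum_add_distrib]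
  congr 1
  · simp
  · split_ifs with h
    · rw [Finset.sum_eq_single ⟨j + 1, h⟩]
      · simp
      · intro i _ hi
        rw [if_neg fun h' => hi (Fin.ext h')]
      · simp
    · exact Finset.sum_eq_zero fun i _ => if_neg (by have := i.2; omega)

theorem charPoly_ne_zero : charPoly α ≠ 0 := by
  intro h
  have := natDegree_charPoly α
  rw [h, natDegree_zero] at this
  exact NeZero.ne p this.symm

theorem pow_eq_of_mem_charRoots {z : ℂ} (hz : z ∈ charRoots α) :
    z ^ p = ∑ i : Fin p, ((α i : ℝ) : ℂ) * z ^ (p - 1 - (i : ℕ)) := by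
  have h1 : (charPoly α).eval z = 0 := by
    have := (mem_roots (charPoly_ne_zero α)).1 (Multiset.mem_toFinset.1 hz)
    exact this
  rw [charPoly, eval_sub, eval_finsetSum] at h1
  simp only [eval_pow, eval_X, eval_mul, eval_C] at h1
  exact sub_eq_zero.1 h1

/-- The solution of the recursion that starts with `0, …, 0, 1`, as a combination of powers of the
roots. -/
noncomputable def powerSum (k : ℕ) : ℂ :=
  ∑ z ∈ charRoots α, z ^ k / ∏ w ∈ (charRoots α).erase z, (z - w)

/-- The sum is the divided difference of `X ^ k` at the `p` distinct roots, that is, the coefficient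
of degree `p - 1` of its interpolant, and `X ^ k` interpolates itself. -/
theorem powerSum_of_lt (h : (charPoly α).roots.Nodup) {k : ℕ} (hk : k + 1 < p) :
    powerSum α k = 0 := by
  have hc := card_charRoots α h
  have := Lagrange.coeff_eq_sum (s := charRoots α) (v := id) (Function.injective_id.injOn)
    (P := (X ^ k : ℂ[X])) (by rw [degree_X_pow, hc]; exact_mod_cast (by omega))
  rw [coeff_X_pow, if_neg (by omega)] at this
  simpa [powerSum] using this.symm

theorem powerSum_pred (h : (charPoly α).roots.Nodup) : powerSum α (p - 1) = 1 := by
  have hc := card_charRoots α h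
  have hp : 0 < p := NeZero.pos p
  have := Lagrange.coeff_eq_sum (s := charRoots α) (v := id) (Function.injective_id.injOn)
    (P := (X ^ (p - 1) : ℂ[X])) (by rw [degree_X_pow, hc]; exact_mod_cast (by omega))
  rw [coeff_X_pow, if_pos (by omega)] at this
  simpa [powerSum] using this.symm

theorem powerSum_add (k : ℕ) :
    powerSum α (k + p) = ∑ i : Fin p, ((α i : ℝ) : ℂ) * powerSum α (k + (p - 1 - (i : ℕ))) := by
  unfold powerSum
  simp_rw [Finset.mul_sum]
  rw [Finset.sum_comm]
  refine Finset.sum_congr rfl fun z hz => ?_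
  rw [pow_add, pow_eq_of_mem_charRoots α hz, Finset.mul_sum, Finset.sum_div]
  refine Finset.sum_congr rfl fun i _ => ?_
  rw [pow_add]; ring

/-- Both sequences solve the same recursion. The vanishing state components with `i > k` correspond
to the `p - 1` initial zeros of `powerSum`. -/
theorem impulse_eq_powerSum (h : (charPoly α).roots.Nodup) (k : ℕ) :
    (impulse α k : ℂ) = powerSum α (k + (p - 1)) := by
  have hp : 0 < p := NeZero.pos p
  induction k using Nat.strong_induction_on with
  | _ k ih =>
    cases k with
    | zero => simp [impulse_zero, powerSum_pred α h]
    | succ k =>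
      have : k + 1 + (p - 1) = k + p := by omega
      rw [this, powerSum_add, impulse_succ]
      push_cast
      refine Finset.sum_congr rfl fun i _ => ?_
      rw [stateImpulse_eq]
      congr 1
      have hi := i.2
      split_ifs with hik
      · rw [ih (k - i) (by omega)]
        congr 1; omega
      · rw [powerSum_of_lt α h (by omega)]; simp

/-- In `z ^ (k + p - 1) / ∏ (z - w)`, one factor `z` is matched with each of the `p - 1`
denominators. This leaves `z ^ k` times the product in `rootConst`, with no division by a root. -/
theorem abs_impulse_le (h : (charPoly α).roots.Nodup) (k : ℕ) :
    |impulse α k| ≤ rootConst α * (rootRadius α : ℝ) ^ k := by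
  have h1 : |impulse α k| = ‖(impulse α k : ℂ)‖ := by simp
  rw [h1, impulse_eq_powerSum α h, powerSum, rootConst, Finset.sum_mul]
  refine (norm_sum_le _ _).trans (Finset.sum_le_sum fun z hz => ?_)
  have hc : ((charRoots α).erase z).card = p - 1 := by
    rw [Finset.card_erase_of_mem hz, card_charRoots α h]
  rw [Finset.prod_div_distrib, Finset.prod_const, hc, pow_add, mul_comm, mul_div_right_comm,
    norm_mul, norm_pow]
  gcongr
  exact norm_le_rootRadius α hz

end Impulse

/-! ### Summability -/

section Summable

variable {p : ℕ} [NeZero p] (α : EuclideanSpace ℝ (Fin p))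

theorem summable_abs_impulse (h : (charPoly α).roots.Nodup) (hr : rootRadius α < 1) :
    Summable fun k => |impulse α k| :=
  Summable.of_nonneg_of_le (fun _ => abs_nonneg _) (abs_impulse_le α h)
    ((summable_geometric_of_lt_one (NNReal.coe_nonneg _) (by exact_mod_cast hr)).mul_left _)

theorem tsum_abs_impulse_le (h : (charPoly α).roots.Nodup) (hr : rootRadius α < 1) :
    ∑' k, |impulse α k| ≤ rootConst α / (1 - rootRadius α) := by
  have hr' : (rootRadius α : ℝ) < 1 := by exact_mod_cast hr
  have hs := summable_geometric_of_lt_one (NNReal.coe_nonneg (rootRadius α)) hr'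
  calc ∑' k, |impulse α k| ≤ ∑' k, rootConst α * (rootRadius α : ℝ) ^ k :=
        (summable_abs_impulse α h hr).tsum_le_tsum (abs_impulse_le α h) (hs.mul_left _)
    _ = rootConst α / (1 - rootRadius α) := by
        rw [tsum_mul_left, tsum_geometric_of_lt_one (NNReal.coe_nonneg _) hr', div_eq_mul_inv]

theorem sum_range_abs_stateImpulse_le (hs : Summable fun k => |impulse α k|) (i : Fin p) (n : ℕ) :
    ∑ k ∈ Finset.range n, |stateImpulse α i k| ≤ ∑' k, |impulse α k| := by
  calc ∑ k ∈ Finset.range n, |stateImpulse α i k|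
      ≤ ∑ k ∈ Finset.range (n + i), |stateImpulse α i k| :=
        Finset.sum_le_sum_of_subset_of_nonneg (Finset.range_mono (by omega))
          fun _ _ _ => abs_nonneg _
    _ = ∑ k ∈ Finset.range n, |impulse α k| := by
        rw [add_comm, Finset.sum_range_add]
        have h1 : ∑ x ∈ Finset.range (i : ℕ), |stateImpulse α i x| = 0 := by
          refine Finset.sum_eq_zero fun k hk => ?_
          rw [stateImpulse_eq, if_neg (by have := Finset.mem_range.1 hk; omega), abs_zero]
        rw [h1, zero_add]
        refine Finset.sum_congr rfl fun k _ => ?_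
        rw [stateImpulse_eq, if_pos (by omega)]
        simp
    _ ≤ ∑' k, |impulse α k| := hs.sum_le_tsum _ fun _ _ => abs_nonneg _

theorem summable_abs_stateImpulse (hs : Summable fun k => |impulse α k|) (i : Fin p) :
    Summable fun k => |stateImpulse α i k| :=
  summable_of_sum_range_le (fun _ => abs_nonneg _) (sum_range_abs_stateImpulse_le α hs i)

/-- Absolutely summable families have summable products. -/
theorem summable_mul_of_summable_abs {f g : ℕ → ℝ} (hf : Summable fun k => |f k|)
    (hg : Summable fun k => |g k|) : Summable fun k => f k * g k := by
  refine Summable.of_norm_bounded (g := fun k => (∑' k, |f k|) * |g k|) (hg.mul_left _) fun k => ?_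
  rw [norm_mul, Real.norm_eq_abs, Real.norm_eq_abs]
  gcongr
  exact hf.le_tsum k fun _ _ => abs_nonneg _

theorem gramPsi_term (k : ℕ) (i j : Fin p) :
    (companion α ^ k * Matrix.vecMulVec (inputVec p) (inputVec p) *
      (companion α).transpose ^ k) i j = stateImpulse α i k * stateImpulse α j k := by
  rw [← Matrix.transpose_pow, Matrix.mul_vecMulVec, Matrix.vecMulVec_mul, Matrix.vecMul_transpose,
    Matrix.vecMulVec_apply, companion_pow_mulVec_inputVec, companion_pow_mulVec_inputVec]

/-- Up to the noise variance, this series is the covariance of `x (t - i)` and `x (t - j)`; it is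
the centering in the concentration bound. -/
theorem hasSum_gramPsi (hs : Summable fun k => |impulse α k|) (i j : Fin p) :
    HasSum (fun k => stateImpulse α i k * stateImpulse α j k) (gramPsi α i j) := by
  have hsum : Summable fun k : ℕ => companion α ^ k *
      Matrix.vecMulVec (inputVec p) (inputVec p) * (companion α).transpose ^ k := by
    refine Pi.summable.2 fun i => Pi.summable.2 fun j => ?_
    simp only [gramPsi_term]
    exact summable_mul_of_summable_abs (summable_abs_stateImpulse α hs i)
      (summable_abs_stateImpulse α hs j)
  have h := Pi.hasSum.1 (Pi.hasSum.1 hsum.hasSum i) j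
  simp only [gramPsi_term] at h
  exact h

theorem gramPsi_isHermitian (hs : Summable fun k => |impulse α k|) :
    (gramPsi α).IsHermitian := by
  ext i j
  rw [Matrix.conjTranspose_apply, star_trivial]
  refine (hasSum_gramPsi α hs j i).unique ?_
  simpa only [mul_comm] using hasSum_gramPsi α hs i j

theorem hasSum_gramPsi_form (hs : Summable fun k => |impulse α k|) (v : Fin p → ℝ) :
    HasSum (fun k => (∑ i, v i * stateImpulse α i k) ^ 2) (v ⬝ᵥ (gramPsi α).mulVec v) := by
  have h1 : v ⬝ᵥ (gramPsi α).mulVec v = ∑ i, ∑ j, v i * v j * gramPsi α i j := by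
    simp only [dotProduct, Matrix.mulVec, Finset.mul_sum]
    exact Finset.sum_congr rfl fun i _ => Finset.sum_congr rfl fun j _ => by ring
  have h2 : ∀ k, (∑ i, v i * stateImpulse α i k) ^ 2 =
      ∑ i, ∑ j, v i * v j * (stateImpulse α i k * stateImpulse α j k) := by
    intro k
    rw [sq, Finset.sum_mul_sum]
    exact Finset.sum_congr rfl fun i _ => Finset.sum_congr rfl fun j _ => by ring
  rw [h1]
  simp only [h2]
  exact hasSum_sum fun i _ => hasSum_sum fun j _ => (hasSum_gramPsi α hs i j).mul_left _

theorem sum_sq_le_of_tsum_abs_le {f : ℕ → ℝ} (hf : Summable fun k => |f k|) {H : ℝ}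
    (hH : ∑' k, |f k| ≤ H) (s : Finset ℕ) : ∑ k ∈ s, f k ^ 2 ≤ H ^ 2 := by
  have h1 : ∑ k ∈ s, |f k| ≤ H := (hf.sum_le_tsum s fun _ _ => abs_nonneg _).trans hH
  calc ∑ k ∈ s, f k ^ 2 = ∑ k ∈ s, |f k| ^ 2 := by simp
    _ ≤ (∑ k ∈ s, |f k|) ^ 2 := Finset.sum_sq_le_sq_sum_of_nonneg fun _ _ => abs_nonneg _
    _ ≤ H ^ 2 := by gcongr

theorem one_le_of_tsum_abs_impulse_le (hs : Summable fun k => |impulse α k|) {H : ℝ}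
    (hH : ∑' k, |impulse α k| ≤ H) : 1 ≤ H := by
  have := (hs.le_tsum 0 fun _ _ => abs_nonneg _).trans hH
  simpa [impulse_zero] using this

/-- The smallest eigenvalue of the controllability Gramian is at most the squared `ℓ¹` norm of the
impulse response. -/
theorem le_sq_of_le_gramPsi_form (hs : Summable fun k => |impulse α k|) {H ψ : ℝ}
    (hH : ∑' k, |impulse α k| ≤ H)
    (hψ : ∀ v : EuclideanSpace ℝ (Fin p), ψ * ‖v‖ ^ 2 ≤ (v : Fin p → ℝ) ⬝ᵥ (gramPsi α).mulVec v) :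
    ψ ≤ H ^ 2 := by
  have h := hψ (EuclideanSpace.single 0 1)
  have h2 := (hasSum_gramPsi_form α hs (EuclideanSpace.single (0 : Fin p) (1 : ℝ)))
  have h3 : ∀ k, ∑ i, (EuclideanSpace.single (0 : Fin p) (1 : ℝ)) i * stateImpulse α i k =
      impulse α k := by
    intro k
    rw [Finset.sum_eq_single 0] <;> simp +contextual [impulse, stateImpulse]
  simp only [h3] at h2
  simp only [PiLp.norm_single, norm_one, one_pow, mul_one] at h
  exact h.trans (hasSum_le_of_sum_le h2 fun s => sum_sq_le_of_tsum_abs_le hs hH s)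

/-- Pairing `α` with the impulse state at time `k` gives `h (k + 1)`, so `αᵀ Ψ α` is a tail of `∑
h²`. This later removes `‖α‖²` from the error bound. -/
theorem mul_norm_sq_le_sq_of_le_gramPsi_form (hs : Summable fun k => |impulse α k|) {H ψ : ℝ}
    (hH : ∑' k, |impulse α k| ≤ H)
    (hψ : ∀ v : EuclideanSpace ℝ (Fin p), ψ * ‖v‖ ^ 2 ≤ (v : Fin p → ℝ) ⬝ᵥ (gramPsi α).mulVec v) :
    ψ * ‖α‖ ^ 2 ≤ H ^ 2 := by
  have h2 := (hasSum_gramPsi_form α hs α)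
  simp only [← impulse_succ] at h2
  refine (hψ α).trans (hasSum_le_of_sum_le h2 fun s => ?_)
  have := sum_sq_le_of_tsum_abs_le hs hH (s.image (· + 1))
  rwa [Finset.sum_image (by simp)] at this

end Summable

/-! ### Extreme eigenvalues of symmetric matrices -/

section Spectral

variable {p : ℕ} {M : Matrix (Fin p) (Fin p) ℝ} (hM : M.IsHermitian)

include hM

theorem lamMin_le_eigenvalues (i : Fin p) : lamMin M ≤ hM.eigenvalues i := by
  rw [lamMin, hM.spectrum_real_eq_range_eigenvalues]
  exact csInf_le (Set.finite_range _).bddBelow ⟨i, rfl⟩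

theorem eigenvalues_le_lamMax (i : Fin p) : hM.eigenvalues i ≤ lamMax M := by
  rw [lamMax, hM.spectrum_real_eq_range_eigenvalues]
  exact le_csSup (Set.finite_range _).bddAbove ⟨i, rfl⟩

theorem quadForm_eq_sum_eigenvalues (v : EuclideanSpace ℝ (Fin p)) :
    (v : Fin p → ℝ) ⬝ᵥ M.mulVec v =
      ∑ k, hM.eigenvalues k * (inner ℝ (hM.eigenvectorBasis k) v) ^ 2 := by
  have h1 : (v : Fin p → ℝ) ⬝ᵥ M.mulVec v = inner ℝ v (WithLp.toLp 2 (M.mulVec v)) := by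
    rw [EuclideanSpace.inner_eq_star_dotProduct, star_trivial, dotProduct_comm]
  rw [h1, ← hM.eigenvectorBasis.sum_inner_mul_inner]
  refine Finset.sum_congr rfl fun k _ => ?_
  have h2 : inner ℝ (hM.eigenvectorBasis k) (WithLp.toLp 2 (M.mulVec v)) =
      hM.eigenvalues k * inner ℝ (hM.eigenvectorBasis k) v := by
    have hT : M.transpose = M := by simpa [Matrix.IsHermitian] using hM
    rw [EuclideanSpace.inner_eq_star_dotProduct, EuclideanSpace.inner_eq_star_dotProduct,
      star_trivial, dotProduct_comm, Matrix.dotProduct_mulVec, ← Matrix.mulVec_transpose, hT,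
      hM.mulVec_eigenvectorBasis, smul_dotProduct, smul_eq_mul, dotProduct_comm]
  rw [h2, real_inner_comm]
  ring

theorem lamMin_mul_norm_sq_le (v : EuclideanSpace ℝ (Fin p)) :
    lamMin M * ‖v‖ ^ 2 ≤ (v : Fin p → ℝ) ⬝ᵥ M.mulVec v := by
  rw [quadForm_eq_sum_eigenvalues hM, ← hM.eigenvectorBasis.sum_sq_inner_right, Finset.mul_sum]
  gcongr with k
  exact lamMin_le_eigenvalues hM k

theorem quadForm_le_lamMax_mul_norm_sq (v : EuclideanSpace ℝ (Fin p)) :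
    (v : Fin p → ℝ) ⬝ᵥ M.mulVec v ≤ lamMax M * ‖v‖ ^ 2 := by
  rw [quadForm_eq_sum_eigenvalues hM, ← hM.eigenvectorBasis.sum_sq_inner_right, Finset.mul_sum]
  gcongr with k
  exact eigenvalues_le_lamMax hM k

theorem lamMin_le_lamMax [NeZero p] : lamMin M ≤ lamMax M :=
  (lamMin_le_eigenvalues hM 0).trans (eigenvalues_le_lamMax hM 0)

/-- The columns of the inverse square root of a positive definite matrix: unit vectors for its
quadratic form, which satisfy a Cauchy-Schwarz inequality for the dual norm. -/
theorem exists_whitening (hpos : 0 < lamMin M) :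
    ∃ V : Fin p → EuclideanSpace ℝ (Fin p),
      (∀ k, (V k : Fin p → ℝ) ⬝ᵥ M.mulVec (V k) = 1) ∧
      ∀ v g : EuclideanSpace ℝ (Fin p), inner ℝ v g ≤
        √((v : Fin p → ℝ) ⬝ᵥ M.mulVec v) * √(∑ k, inner ℝ (V k) g ^ 2) := by
  have hev : ∀ k, 0 < hM.eigenvalues k := fun k => hpos.trans_le (lamMin_le_eigenvalues hM k)
  refine ⟨fun k => (√(hM.eigenvalues k))⁻¹ • hM.eigenvectorBasis k, fun k => ?_, fun v g => ?_⟩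
  · rw [quadForm_eq_sum_eigenvalues hM, Finset.sum_eq_single k]
    · rw [inner_smul_right, real_inner_self_eq_norm_sq, hM.eigenvectorBasis.norm_eq_one, one_pow,
        mul_one, inv_pow, Real.sq_sqrt (hev k).le, mul_inv_cancel₀ (hev k).ne']
    · intro j _ hj
      rw [inner_smul_right, hM.eigenvectorBasis.orthonormal.2 hj]; simp
    · simp
  · have h1 : inner ℝ v g = ∑ k, (√(hM.eigenvalues k) * inner ℝ (hM.eigenvectorBasis k) v) *
        inner ℝ ((√(hM.eigenvalues k))⁻¹ • hM.eigenvectorBasis k) g := by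
      rw [← hM.eigenvectorBasis.sum_inner_mul_inner]
      refine Finset.sum_congr rfl fun k _ => ?_
      have := Real.sqrt_pos.2 (hev k)
      rw [real_inner_smul_left, real_inner_comm]
      field_simp
    rw [h1, quadForm_eq_sum_eigenvalues hM]
    refine (Real.sum_mul_le_sqrt_mul_sqrt _ _ _).trans (le_of_eq ?_)
    congr 2
    refine Finset.sum_congr rfl fun k _ => ?_
    rw [mul_pow, Real.sq_sqrt (hev k).le]

end Spectral

theorem lamMax_zero {p : ℕ} [NeZero p] : lamMax (0 : Matrix (Fin p) (Fin p) ℝ) = 0 := by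
  rw [lamMax, spectrum.zero_eq, csSup_singleton]

/-- If the series defining `Γ` diverges then its value is zero; otherwise `Γ` dominates the
identity. -/
theorem lamMax_gramGamma_eq_zero_or_one_le {p : ℕ} [NeZero p] (α : EuclideanSpace ℝ (Fin p)) :
    lamMax (gramGamma α) = 0 ∨ 1 ≤ lamMax (gramGamma α) := by
  by_cases hs : Summable fun t : ℕ => companion α ^ t * (companion α).transpose ^ t
  swap
  · left
    rw [gramGamma, tsum_eq_zero_of_not_summable hs, lamMax_zero]
  right
  have hsum : ∀ i j, HasSum (fun t : ℕ => (companion α ^ t * (companion α).transpose ^ t) i j)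
      (gramGamma α i j) := fun i j => Pi.hasSum.1 (Pi.hasSum.1 hs.hasSum i) j
  have hsymm : (gramGamma α).IsHermitian := by
    ext i j
    rw [Matrix.conjTranspose_apply, star_trivial]
    refine (hsum j i).unique ?_
    convert hsum i j using 2 with t
    rw [← Matrix.transpose_pow, Matrix.mul_apply, Matrix.mul_apply]
    exact Finset.sum_congr rfl fun _ _ => mul_comm _ _
  have h1 : 1 ≤ gramGamma α 0 0 := by
    have := le_hasSum (hsum 0 0) 0 fun t _ => by
      rw [← Matrix.transpose_pow, Matrix.mul_apply]
      exact Finset.sum_nonneg fun _ _ => mul_self_nonneg _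
    simpa using this
  have h2 := quadForm_le_lamMax_mul_norm_sq hsymm (EuclideanSpace.single 0 1)
  simp only [PiLp.norm_single, norm_one, one_pow, mul_one] at h2
  refine h1.trans (le_trans (le_of_eq ?_) h2)
  simp

namespace ARFamily

variable {N : ℕ} (M : ARFamily N)

theorem gammaMax_eq_zero_or_one_le : M.gammaMax = 0 ∨ 1 ≤ M.gammaMax := by
  rcases isEmpty_or_nonempty (Fin N) with hN | hN
  · simp [gammaMax]
  · obtain ⟨n, hn⟩ := exists_eq_ciSup_of_finite (f := fun n => lamMax (gramGamma (M.α n)))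
    have : NeZero (M.p n) := ⟨(M.p_pos n).ne'⟩
    rw [gammaMax, ← hn]
    exact lamMax_gramGamma_eq_zero_or_one_le _

end ARFamily

/-! ### Exponential moments -/

section ExpMoment

open scoped ENNReal

variable {Ω : Type*} [MeasurableSpace Ω] {μ : Measure Ω}

/-- The exponential moment `E[exp X]`, possibly infinite. -/
noncomputable def expMoment (μ : Measure Ω) (X : Ω → ℝ) : ℝ≥0∞ :=
  ∫⁻ ω, ENNReal.ofReal (Real.exp (X ω)) ∂μ

/-- Fatou's lemma: exponential moment bounds proved for finite truncations of a filter pass to the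
limit without any integrability of the limit. -/
theorem expMoment_le_of_tendsto {K : ℝ≥0∞} {X : ℕ → Ω → ℝ} {Y : Ω → ℝ}
    (hX : ∀ n, Measurable (X n)) (hK : ∀ n, expMoment μ (X n) ≤ K)
    (hlim : ∀ᵐ ω ∂μ, Filter.Tendsto (fun n => X n ω) Filter.atTop (nhds (Y ω))) :
    expMoment μ Y ≤ K := by
  calc expMoment μ Y
      = ∫⁻ ω, Filter.liminf (fun n => ENNReal.ofReal (Real.exp (X n ω))) Filter.atTop ∂μ := by
        refine lintegral_congr_ae ?_
        filter_upwards [hlim] with ω hω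
        exact (ENNReal.tendsto_ofReal ((Real.continuous_exp.tendsto _).comp hω)).liminf_eq.symm
    _ ≤ Filter.liminf (fun n => ∫⁻ ω, ENNReal.ofReal (Real.exp (X n ω)) ∂μ) Filter.atTop :=
        lintegral_liminf_le fun n => (hX n).exp.ennreal_ofReal
    _ ≤ K := Filter.liminf_le_of_le (by isBoundedDefault) fun b hb => by
        obtain ⟨n, hn⟩ := hb.exists
        exact hn.trans (hK n)

theorem measure_ge_le_of_expMoment_le {K : ℝ≥0∞} {X : Ω → ℝ} (hX : AEMeasurable X μ)
    (hK : expMoment μ X ≤ K) (u : ℝ) :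
    μ {ω | u ≤ X ω} ≤ K * ENNReal.ofReal (Real.exp (-u)) := by
  have h := meas_ge_le_lintegral_div (μ := μ) (f := fun ω => ENNReal.ofReal (Real.exp (X ω)))
    (ε := ENNReal.ofReal (Real.exp u)) (hX.exp.ennreal_ofReal)
    (by simpa using Real.exp_pos u) ENNReal.ofReal_ne_top
  have h2 : {ω | u ≤ X ω} =
      {ω | ENNReal.ofReal (Real.exp u) ≤ ENNReal.ofReal (Real.exp (X ω))} := by
    ext ω
    simp [ENNReal.ofReal_le_ofReal_iff (Real.exp_pos _).le]
  rw [h2]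
  refine h.trans ?_
  rw [Real.exp_neg, ENNReal.ofReal_inv_of_pos (Real.exp_pos u), ← ENNReal.div_eq_inv_mul.trans (mul_comm _ _)]
  gcongr
  exact hK

/-- Jensen's inequality for a signed combination of variables whose exponential moments are
bounded near the origin. -/
theorem expMoment_sum_le {ι : Type*} (I : Finset ι) (b : ι → ℝ) (W : ι → Ω → ℝ)
    [IsProbabilityMeasure μ] (hW : ∀ i, Measurable (W i)) {K : ℝ≥0∞} (hK1 : 1 ≤ K) {s₁ : ℝ}
    (hK : ∀ i ∈ I, ∀ s, |s| ≤ s₁ → expMoment μ (fun ω => s * W i ω) ≤ K) {s : ℝ}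
    (hs : |s| * ∑ i ∈ I, |b i| ≤ s₁) :
    expMoment μ (fun ω => s * ∑ i ∈ I, b i * W i ω) ≤ K := by
  set B := ∑ i ∈ I, |b i| with hB
  have hB0 : 0 ≤ B := Finset.sum_nonneg fun _ _ => abs_nonneg _
  rcases hB0.eq_or_lt with hB0 | hB0
  · have hz : ∀ i ∈ I, b i = 0 := fun i hi =>
      abs_eq_zero.1 ((Finset.sum_eq_zero_iff_of_nonneg fun _ _ => abs_nonneg _).1 hB0.symm i hi)
    have : ∀ ω, s * ∑ i ∈ I, b i * W i ω = 0 := fun ω => by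
      rw [Finset.sum_eq_zero fun i hi => by rw [hz i hi, zero_mul], mul_zero]
    simpa [expMoment, this] using hK1
  -- With weights `|b i| / B`, the sign and the total mass move into the argument, whose modulus is
  -- at most `|s| * B ≤ s₁`.
  · set r : ι → ℝ := fun i => s * B * SignType.sign (b i) with hr
    have hr1 : ∀ i ∈ I, expMoment μ (fun ω => r i * W i ω) ≤ K := fun i hi => by
      refine hK i hi _ (le_trans ?_ hs)
      rw [hr, abs_mul, abs_mul, abs_of_pos hB0]
      refine mul_le_of_le_one_right (by positivity) ?_
      cases SignType.sign (b i) <;> simp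
    have hpt : ∀ ω, Real.exp (s * ∑ i ∈ I, b i * W i ω) ≤
        ∑ i ∈ I, (|b i| / B) * Real.exp (r i * W i ω) := fun ω => by
      have hj := convexOn_exp.map_sum_le (t := I) (w := fun i => |b i| / B)
        (p := fun i => r i * W i ω) (fun i _ => by positivity)
        (by rw [← Finset.sum_div, ← hB, div_self hB0.ne']) (fun _ _ => Set.mem_univ _)
      simp only [smul_eq_mul] at hj
      refine le_trans (le_of_eq ?_) hj
      rw [Finset.mul_sum]
      congr 1
      refine Finset.sum_congr rfl fun i _ => ?_
      have : |b i| * SignType.sign (b i) = b i := abs_mul_sign (b i)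
      rw [hr]
      field_simp
      linear_combination (-s * W i ω) * this
    calc expMoment μ (fun ω => s * ∑ i ∈ I, b i * W i ω)
        ≤ ∫⁻ ω, ∑ i ∈ I, ENNReal.ofReal (|b i| / B) *
            ENNReal.ofReal (Real.exp (r i * W i ω)) ∂μ := by
          refine lintegral_mono fun ω => ?_
          refine (ENNReal.ofReal_le_ofReal (hpt ω)).trans (le_of_eq ?_)
          rw [ENNReal.ofReal_sum_of_nonneg fun i _ => by positivity]
          exact Finset.sum_congr rfl fun i _ => ENNReal.ofReal_mul (by positivity)
      _ = ∑ i ∈ I, ENNReal.ofReal (|b i| / B) * expMoment μ (fun ω => r i * W i ω) := by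
          have hm : ∀ i, Measurable fun ω => ENNReal.ofReal (Real.exp (r i * W i ω)) := fun i =>
            ((hW i).const_mul _).exp.ennreal_ofReal
          rw [lintegral_finsetSum _ fun i _ => (hm i).const_mul _]
          exact Finset.sum_congr rfl fun i _ => lintegral_const_mul _ (hm i)
      _ ≤ ∑ i ∈ I, ENNReal.ofReal (|b i| / B) * K := by
          gcongr with i hi
          exact hr1 i hi
      _ = K := by
          rw [← Finset.sum_mul, ← ENNReal.ofReal_sum_of_nonneg fun i _ => by positivity,
            ← Finset.sum_div, ← hB, div_self hB0.ne', ENNReal.ofReal_one, one_mul]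

/-- One step of the exponential supermartingale. -/
theorem expMoment_add_le {Ω : Type*} {m : MeasurableSpace Ω} {mΩ : MeasurableSpace Ω} {μ : Measure Ω}
    [IsProbabilityMeasure μ] (hm : m ≤ mΩ) {G Y X : Ω → ℝ}
    (hG : Measurable[m] G) (hY : Measurable[m] Y) (hX : Measurable X)
    (hind : Indep m (MeasurableSpace.comap X inferInstance) μ) {c : ℝ}
    (hc : ∀ s, expMoment μ (fun ω => s * X ω) ≤ ENNReal.ofReal (Real.exp (c * s ^ 2 / 2))) :
    expMoment μ (fun ω => G ω + (Y ω * X ω - c / 2 * Y ω ^ 2)) ≤ expMoment μ G := by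
  have hGY : Measurable[m] fun ω => (G ω, Y ω) := hG.prodMk hY
  have hGY' : Measurable fun ω => (G ω, Y ω) := hGY.mono hm le_rfl
  -- The pair `(G, Y)` is independent of `X`, so the joint law is a product and conditioning on the
  -- past becomes integrating `X` out first.
  have hind' : IndepFun (fun ω => (G ω, Y ω)) X μ :=
    indep_of_indep_of_le_left hind hGY.comap_le
  have hmap := (indepFun_iff_map_prod_eq_prod_map_map hGY'.aemeasurable hX.aemeasurable).1 hind'
  have hF : Measurable fun q : (ℝ × ℝ) × ℝ =>
      ENNReal.ofReal (Real.exp (q.1.1 + (q.1.2 * q.2 - c / 2 * q.1.2 ^ 2))) := by fun_prop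
  have h1 : expMoment μ (fun ω => G ω + (Y ω * X ω - c / 2 * Y ω ^ 2)) =
      ∫⁻ q, ENNReal.ofReal (Real.exp (q.1.1 + (q.1.2 * q.2 - c / 2 * q.1.2 ^ 2)))
        ∂(μ.map fun ω => ((G ω, Y ω), X ω)) := by
    rw [lintegral_map hF (hGY'.prodMk hX)]; rfl
  have : IsProbabilityMeasure (μ.map X) := Measure.isProbabilityMeasure_map hX.aemeasurable
  have : IsProbabilityMeasure (μ.map fun ω => (G ω, Y ω)) :=
    Measure.isProbabilityMeasure_map hGY'.aemeasurable
  rw [h1, hmap, lintegral_prod _ hF.aemeasurable]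
  have h2 : ∀ q : ℝ × ℝ, ∫⁻ x, ENNReal.ofReal (Real.exp (q.1 + (q.2 * x - c / 2 * q.2 ^ 2)))
      ∂(μ.map X) ≤ ENNReal.ofReal (Real.exp q.1) := fun q => by
    have h3 : ∀ x, ENNReal.ofReal (Real.exp (q.1 + (q.2 * x - c / 2 * q.2 ^ 2))) =
        ENNReal.ofReal (Real.exp (q.1 - c * q.2 ^ 2 / 2)) *
          ENNReal.ofReal (Real.exp (q.2 * x)) := fun x => by
      rw [← ENNReal.ofReal_mul (Real.exp_pos _).le, ← Real.exp_add]
      congr 2; ring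
    simp only [h3]
    rw [lintegral_const_mul _ (by fun_prop), lintegral_map (by fun_prop) hX]
    refine (mul_le_mul_right (hc q.2) _).trans ?_
    rw [← ENNReal.ofReal_mul (Real.exp_pos _).le, ← Real.exp_add]
    simp
  refine (lintegral_mono h2).trans (le_of_eq ?_)
  rw [lintegral_map (by fun_prop) hGY']
  rfl

/-- The Gaussian integral that linearizes the square in the exponent. -/
theorem lintegral_exp_mul_sub_sq {c : ℝ} (hc : 0 < c) (x : ℝ) :
    ∫⁻ g : ℝ, ENNReal.ofReal (Real.exp (g * x - 2 * c * g ^ 2)) =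
      ENNReal.ofReal (Real.exp (x ^ 2 / (8 * c))) * ENNReal.ofReal √(Real.pi / (2 * c)) := by
  have h1 : ∀ g : ℝ, ENNReal.ofReal (Real.exp (g * x - 2 * c * g ^ 2)) =
      ENNReal.ofReal (Real.exp (x ^ 2 / (8 * c))) *
        ENNReal.ofReal (Real.exp (-(2 * c) * (g - x / (4 * c)) ^ 2)) := fun g => by
    rw [← ENNReal.ofReal_mul (Real.exp_pos _).le, ← Real.exp_add]
    congr 2; field_simp; ring
  simp only [h1]
  rw [lintegral_const_mul _ (by fun_prop),
    lintegral_sub_right_eq_self (fun g => ENNReal.ofReal (Real.exp (-(2 * c) * g ^ 2))),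
    ← ofReal_integral_eq_lintegral_ofReal (integrable_exp_neg_mul_sq (by positivity))
      (Filter.Eventually.of_forall fun _ => (Real.exp_pos _).le), integral_gaussian]

/-- Sub-gaussian variables have exponentially integrable squares. -/
theorem expMoment_sq_le [IsProbabilityMeasure μ] {X : Ω → ℝ} (hX : Measurable X) {c : ℝ}
    (hc : 0 < c)
    (hmgf : ∀ s, expMoment μ (fun ω => s * X ω) ≤ ENNReal.ofReal (Real.exp (c * s ^ 2 / 2))) :
    expMoment μ (fun ω => X ω ^ 2 / (8 * c)) ≤ 2 := by
  have hpos : 0 < √(Real.pi / (2 * c)) := by positivity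
  have h1 : expMoment μ (fun ω => X ω ^ 2 / (8 * c)) * ENNReal.ofReal √(Real.pi / (2 * c)) ≤
      ENNReal.ofReal √(Real.pi / (3 / 2 * c)) := by
    calc expMoment μ (fun ω => X ω ^ 2 / (8 * c)) * ENNReal.ofReal √(Real.pi / (2 * c))
        = ∫⁻ ω, (∫⁻ g : ℝ, ENNReal.ofReal (Real.exp (g * X ω - 2 * c * g ^ 2))) ∂μ := by
          simp only [lintegral_exp_mul_sub_sq hc]
          rw [lintegral_mul_const _ (by fun_prop)]; rfl
      _ = ∫⁻ g : ℝ, ∫⁻ ω, ENNReal.ofReal (Real.exp (g * X ω - 2 * c * g ^ 2)) ∂μ :=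
          lintegral_lintegral_swap (by fun_prop)
      _ ≤ ∫⁻ g : ℝ, ENNReal.ofReal (Real.exp (-(3 / 2 * c) * g ^ 2)) := by
          refine lintegral_mono fun g => ?_
          have h3 : ∀ ω, ENNReal.ofReal (Real.exp (g * X ω - 2 * c * g ^ 2)) =
              ENNReal.ofReal (Real.exp (-(2 * c * g ^ 2))) *
                ENNReal.ofReal (Real.exp (g * X ω)) := fun ω => by
            rw [← ENNReal.ofReal_mul (Real.exp_pos _).le, ← Real.exp_add]
            congr 2; ring
          simp only [h3]
          rw [lintegral_const_mul _ (by fun_prop)]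
          refine (mul_le_mul_right (hmgf g) _).trans (le_of_eq ?_)
          rw [← ENNReal.ofReal_mul (Real.exp_pos _).le, ← Real.exp_add]
          congr 2; ring
      _ = ENNReal.ofReal √(Real.pi / (3 / 2 * c)) := by
          rw [← ofReal_integral_eq_lintegral_ofReal (integrable_exp_neg_mul_sq (by positivity))
            (Filter.Eventually.of_forall fun _ => (Real.exp_pos _).le), integral_gaussian]
  -- The true ratio of the two Gaussian integrals is `√(4 / 3)`; `2` is a convenient bound.
  have h2 : ENNReal.ofReal √(Real.pi / (3 / 2 * c)) ≤
      2 * ENNReal.ofReal √(Real.pi / (2 * c)) := by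
    rw [← ENNReal.ofReal_ofNat 2, ← ENNReal.ofReal_mul (by norm_num)]
    refine ENNReal.ofReal_le_ofReal ?_
    rw [show (2 : ℝ) = √4 by rw [show (4 : ℝ) = 2 ^ 2 by norm_num]; simp, ← Real.sqrt_mul (by norm_num)]
    refine Real.sqrt_le_sqrt ?_
    rw [show √(4 : ℝ) = 2 by rw [show (4 : ℝ) = 2 ^ 2 by norm_num]; simp, ← mul_div_assoc,
      div_le_div_iff₀ (by positivity) (by positivity)]
    nlinarith [mul_pos Real.pi_pos hc]
  exact (ENNReal.mul_le_mul_iff_left (by simpa using hpos) ENNReal.ofReal_ne_top).1 (h1.trans h2)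

theorem exp_le_one_add_add_sq_mul_exp_abs (y : ℝ) :
    Real.exp y ≤ 1 + y + y ^ 2 * Real.exp |y| := by
  have h := Complex.norm_exp_sub_sum_le_norm_mul_exp (y : ℂ) 2
  have h2 : Complex.exp y - ∑ m ∈ Finset.range 2, (y : ℂ) ^ m / m.factorial =
      ((Real.exp y - (1 + y) : ℝ) : ℂ) := by
    simp [Finset.sum_range_succ]
  rw [h2, Complex.norm_real, Complex.norm_real, Real.norm_eq_abs, Real.norm_eq_abs, sq_abs] at h
  linarith [le_abs_self (Real.exp y - (1 + y))]

/-- Centered squares of sub-gaussian variables are sub-exponential. -/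
theorem expMoment_centered_sq_le [IsProbabilityMeasure μ] {X : Ω → ℝ} (hX : Measurable X)
    {c v : ℝ} (hc : 0 < c)
    (hmgf : ∀ s, expMoment μ (fun ω => s * X ω) ≤ ENNReal.ofReal (Real.exp (c * s ^ 2 / 2)))
    (hint : Integrable (fun ω => X ω ^ 2) μ) (hv : ∫ ω, X ω ^ 2 ∂μ = v) (hv0 : 0 ≤ v)
    (hvc : v ≤ c) {s : ℝ} (hs : |s| ≤ 1 / (16 * c)) :
    expMoment μ (fun ω => s * (X ω ^ 2 - v)) ≤ ENNReal.ofReal (Real.exp (2048 * c ^ 2 * s ^ 2)) := by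
  have hE := expMoment_sq_le hX hc hmgf
  have hEint : Integrable (fun ω => Real.exp (X ω ^ 2 / (8 * c))) μ := by
    refine ⟨by fun_prop, ?_⟩
    rw [hasFiniteIntegral_iff_ofReal (Filter.Eventually.of_forall fun _ => (Real.exp_pos _).le)]
    exact hE.trans_lt (by simp)
  have hEle : ∫ ω, Real.exp (X ω ^ 2 / (8 * c)) ∂μ ≤ 2 := by
    rw [integral_eq_lintegral_of_nonneg_ae
      (Filter.Eventually.of_forall fun _ => (Real.exp_pos _).le) (by fun_prop)]
    exact ENNReal.toReal_le_of_le_ofReal (by norm_num) (by rw [ENNReal.ofReal_ofNat]; exact hE)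
  -- Second-order Taylor: the linear term integrates to zero. With `w = x² + c`, both `w²` and the
  -- exponential of the remainder are bounded by multiples of `exp (w / (16 c))`; their product just
  -- fits the integrable `exp (x² / (8 c))`.
  have hpt : ∀ x : ℝ, Real.exp (s * (x ^ 2 - v)) ≤
      1 + s * (x ^ 2 - v) + 1024 * c ^ 2 * s ^ 2 * Real.exp (x ^ 2 / (8 * c)) := fun x => by
    refine (exp_le_one_add_add_sq_mul_exp_abs _).trans ?_
    have hw : |x ^ 2 - v| ≤ x ^ 2 + c := by
      rw [abs_le]; constructor <;> nlinarith [sq_nonneg x]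
    set w := x ^ 2 + c with hwdef
    have hw0 : 0 ≤ w := by positivity
    have h1 : |s * (x ^ 2 - v)| ≤ w / (16 * c) := by
      rw [abs_mul]
      calc |s| * |x ^ 2 - v| ≤ 1 / (16 * c) * w := by gcongr
        _ = w / (16 * c) := by ring
    have h2 : (s * (x ^ 2 - v)) ^ 2 ≤ s ^ 2 * w ^ 2 := by
      rw [mul_pow, ← sq_abs (x ^ 2 - v)]; gcongr
    have h3 : w ^ 2 ≤ 512 * c ^ 2 * Real.exp (w / (16 * c)) := by
      have := Real.quadratic_le_exp_of_nonneg (x := w / (16 * c)) (by positivity)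
      have h4 : (w / (16 * c)) ^ 2 / 2 ≤ Real.exp (w / (16 * c)) := by
        have : 0 ≤ w / (16 * c) := by positivity
        linarith
      calc w ^ 2 = 512 * c ^ 2 * ((w / (16 * c)) ^ 2 / 2) := by field_simp; ring
        _ ≤ _ := by gcongr
    have h5 : Real.exp (w / (16 * c)) * Real.exp (w / (16 * c)) ≤
        2 * Real.exp (x ^ 2 / (8 * c)) := by
      rw [← Real.exp_add]
      have h6 : w / (16 * c) + w / (16 * c) = 1 / 8 + x ^ 2 / (8 * c) := by
        rw [hwdef]; field_simp; ring
      rw [h6, Real.exp_add]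
      gcongr
      have := Real.exp_one_lt_d9
      have h7 : Real.exp (1 / 8) ^ 8 = Real.exp 1 := by rw [← Real.exp_nat_mul]; norm_num
      by_contra hcon
      have : (2 : ℝ) ^ 8 ≤ Real.exp (1 / 8) ^ 8 := by gcongr; linarith
      norm_num at this
      linarith
    calc 1 + s * (x ^ 2 - v) + (s * (x ^ 2 - v)) ^ 2 * Real.exp |s * (x ^ 2 - v)|
        ≤ 1 + s * (x ^ 2 - v) + s ^ 2 * (512 * c ^ 2 * Real.exp (w / (16 * c))) *
            Real.exp (w / (16 * c)) := by
          gcongr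
          exact h2.trans (by gcongr)
      _ = 1 + s * (x ^ 2 - v) + s ^ 2 * (512 * c ^ 2) *
            (Real.exp (w / (16 * c)) * Real.exp (w / (16 * c))) := by ring
      _ ≤ 1 + s * (x ^ 2 - v) + s ^ 2 * (512 * c ^ 2) * (2 * Real.exp (x ^ 2 / (8 * c))) := by
          gcongr
      _ = _ := by ring
  have hci : Integrable (fun ω => s * (X ω ^ 2 - v)) μ :=
    (hint.sub (integrable_const v)).const_mul s
  have hri : Integrable (fun ω => 1 + s * (X ω ^ 2 - v) +
      1024 * c ^ 2 * s ^ 2 * Real.exp (X ω ^ 2 / (8 * c))) μ :=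
    ((integrable_const _).add hci).add (hEint.const_mul _)
  have hnn : ∀ ω, 0 ≤ 1 + s * (X ω ^ 2 - v) +
      1024 * c ^ 2 * s ^ 2 * Real.exp (X ω ^ 2 / (8 * c)) := fun ω =>
    (Real.exp_pos _).le.trans (hpt (X ω))
  calc expMoment μ (fun ω => s * (X ω ^ 2 - v))
      ≤ ∫⁻ ω, ENNReal.ofReal (1 + s * (X ω ^ 2 - v) +
          1024 * c ^ 2 * s ^ 2 * Real.exp (X ω ^ 2 / (8 * c))) ∂μ :=
        lintegral_mono fun ω => ENNReal.ofReal_le_ofReal (hpt (X ω))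
    _ = ENNReal.ofReal (∫ ω, (1 + s * (X ω ^ 2 - v) +
          1024 * c ^ 2 * s ^ 2 * Real.exp (X ω ^ 2 / (8 * c))) ∂μ) :=
        (ofReal_integral_eq_lintegral_ofReal hri (Filter.Eventually.of_forall hnn)).symm
    _ ≤ ENNReal.ofReal (Real.exp (2048 * c ^ 2 * s ^ 2)) := by
        refine ENNReal.ofReal_le_ofReal ?_
        have e1 : ∫ ω, (1 + s * (X ω ^ 2 - v) +
            1024 * c ^ 2 * s ^ 2 * Real.exp (X ω ^ 2 / (8 * c))) ∂μ =
            1 + 1024 * c ^ 2 * s ^ 2 * ∫ ω, Real.exp (X ω ^ 2 / (8 * c)) ∂μ := by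
          have hi1 : Integrable (fun ω => 1 + s * (X ω ^ 2 - v)) μ :=
            (integrable_const _).add hci
          rw [integral_add hi1 (hEint.const_mul _), integral_add (integrable_const _) hci, integral_const_mul, integral_const_mul,
            integral_sub hint (integrable_const _), hv]
          simp
        rw [e1]
        have := Real.add_one_le_exp (2048 * c ^ 2 * s ^ 2)
        have h0 : 0 ≤ 1024 * c ^ 2 * s ^ 2 := by positivity
        nlinarith

end ExpMoment

/-! ### Independent sub-gaussian noise -/

section Noise

open scoped ENNReal

variable {Ω : Type*} {e : ℤ → Ω → ℝ}

/-- The information contained in the variables before time `t`. -/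
abbrev pastAlgebra (e : ℤ → Ω → ℝ) (t : ℤ) : MeasurableSpace Ω :=
  ⨆ s ∈ Set.Iio t, MeasurableSpace.comap (e s) inferInstance

theorem measurable_pastAlgebra {s t : ℤ} (h : s < t) : Measurable[pastAlgebra e t] (e s) :=
  measurable_iff_comap_le.2
    (le_iSup₂ (f := fun s (_ : s ∈ Set.Iio t) => MeasurableSpace.comap (e s) inferInstance) s h)

theorem pastAlgebra_mono {s t : ℤ} (h : s ≤ t) : pastAlgebra e s ≤ pastAlgebra e t :=
  biSup_mono fun _ hr => lt_of_lt_of_le hr h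

variable [MeasurableSpace Ω] {μ : Measure Ω} {v c : ℝ}

/-- Independent variables, indexed by the integers, with second moment `v` and sub-gaussian with
variance proxy `c ≥ v`. -/
structure IsNoise (μ : Measure Ω) (v c : ℝ) (e : ℤ → Ω → ℝ) : Prop where
  measurable : ∀ t, Measurable (e t)
  indep : iIndepFun e μ
  proxy_pos : 0 < c
  second_moment_nonneg : 0 ≤ v
  second_moment_le : v ≤ c
  integrable_sq : ∀ t, Integrable (fun ω => e t ω ^ 2) μ
  second_moment : ∀ t, ∫ ω, e t ω ^ 2 ∂μ = v
  expMoment_le : ∀ t s, expMoment μ (fun ω => s * e t ω) ≤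
    ENNReal.ofReal (Real.exp (c * s ^ 2 / 2))

namespace IsNoise

variable (hn : IsNoise μ v c e)

include hn

theorem pastAlgebra_le (t : ℤ) : pastAlgebra e t ≤ ‹MeasurableSpace Ω› :=
  iSup₂_le fun s _ => (hn.measurable s).comap_le

theorem indep_pastAlgebra (t : ℤ) :
    Indep (pastAlgebra e t) (MeasurableSpace.comap (e t) inferInstance) μ := by
  have := indep_iSup_of_disjoint (fun s => (hn.measurable s).comap_le)
    ((iIndepFun_iff_iIndep _ _ _).1 hn.indep) (S := Set.Iio t) (T := {t}) (by simp)
  simpa [pastAlgebra] using this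

/-- Predictable combinations of the noise, with a quadratic compensator, have bounded exponential
moments. -/
theorem expMoment_predictable_le [IsProbabilityMeasure μ] (a : ℤ) (Y : ℕ → Ω → ℝ)
    (hY : ∀ i : ℕ, Measurable[pastAlgebra e (a + i)] (Y i)) (n : ℕ) :
    expMoment μ (fun ω => ∑ i ∈ Finset.range n, (Y i ω * e (a + i) ω - c / 2 * Y i ω ^ 2)) ≤ 1 := by
  induction n with
  | zero => simp [expMoment]
  | succ n ih =>
    simp only [Finset.sum_range_succ]
    refine (expMoment_add_le (hn.pastAlgebra_le (a + n)) ?_ (hY n) (hn.measurable _)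
      (hn.indep_pastAlgebra _) (hn.expMoment_le _)).trans ih
    refine Finset.measurable_sum _ fun i hi => ?_
    have hi' : (i : ℤ) < n := by exact_mod_cast Finset.mem_range.1 hi
    have h1 : Measurable[pastAlgebra e (a + n)] (Y i) :=
      (hY i).mono (pastAlgebra_mono (by omega)) le_rfl
    exact (h1.mul (measurable_pastAlgebra (by omega))).sub ((h1.pow_const 2).const_mul _)

/-- Exponential moments of the sum of the centered squares over a window. -/
theorem expMoment_sum_sq_le [IsProbabilityMeasure μ] (a : ℤ) (n : ℕ) {s : ℝ}
    (hs : |s| ≤ 1 / (16 * c)) :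
    expMoment μ (fun ω => s * ∑ i ∈ Finset.range n, (e (a + i) ω ^ 2 - v)) ≤
      ENNReal.ofReal (Real.exp (2048 * c ^ 2 * s ^ 2 * n)) := by
  have hind : iIndepFun (fun t ω => ENNReal.ofReal (Real.exp (s * (e t ω ^ 2 - v)))) μ :=
    hn.indep.comp (fun _ x => ENNReal.ofReal (Real.exp (s * (x ^ 2 - v)))) fun _ => by fun_prop
  have hm := hn.measurable
  have h1 : ∀ ω, ENNReal.ofReal (Real.exp (s * ∑ i ∈ Finset.range n, (e (a + i) ω ^ 2 - v))) =
      ∏ t ∈ (Finset.range n).image (fun i : ℕ => a + i),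
        ENNReal.ofReal (Real.exp (s * (e t ω ^ 2 - v))) := fun ω => by
    rw [Finset.prod_image (by simp), Finset.mul_sum, Real.exp_sum,
      ENNReal.ofReal_prod_of_nonneg fun _ _ => (Real.exp_pos _).le]
  unfold expMoment
  simp only [h1]
  rw [lintegral_prod_eq_prod_lintegral_of_indepFun _ _ hind fun t => by
    have := hm t; fun_prop]
  refine (Finset.prod_le_prod' fun t _ => expMoment_centered_sq_le (hn.measurable t) hn.proxy_pos
    (hn.expMoment_le t) (hn.integrable_sq t) (hn.second_moment t) hn.second_moment_nonneg
    hn.second_moment_le hs).trans ?_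
  rw [Finset.prod_const, Finset.card_image_of_injective _ (fun i j h => by simpa using h),
    Finset.card_range, ← ENNReal.ofReal_pow (Real.exp_pos _).le, ← Real.exp_nat_mul]
  apply le_of_eq
  congr 2; ring

/-- The earlier factor is predictable for the later one. Adding and subtracting the compensator
writes the exponent as the average of `X`, a compensated sum taken at `2 * s`, and of `Z + q`, a
small multiple of the sum of squares. The exponential of an average is at most the sum of the
exponentials. -/
theorem expMoment_lag_lt_le [IsProbabilityMeasure μ] {a b : ℤ} (hab : b < a) {n T : ℕ}
    (hT : 0 < T) (hnT : n ≤ T) {s : ℝ} (hs : |s| ≤ 1 / (16 * c * √T)) :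
    expMoment μ (fun ω => s * ∑ i ∈ Finset.range n, e (a + i) ω * e (b + i) ω) ≤
      ENNReal.ofReal (Real.exp 8) := by
  have hc := hn.proxy_pos
  have hT' : (0 : ℝ) < T := by exact_mod_cast hT
  have hnT' : (n : ℝ) ≤ T := by exact_mod_cast hnT
  have hm := hn.measurable
  set X : Ω → ℝ := fun ω => ∑ i ∈ Finset.range n,
    (2 * s * e (b + i) ω * e (a + i) ω - c / 2 * (2 * s * e (b + i) ω) ^ 2) with hX
  set Z : Ω → ℝ := fun ω => 2 * c * s ^ 2 * ∑ i ∈ Finset.range n, (e (b + i) ω ^ 2 - v) with hZ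
  set q : ℝ := 2 * c * s ^ 2 * (n * v) with hq
  have hXm : expMoment μ X ≤ 1 := by
    refine hn.expMoment_predictable_le a (fun i ω => 2 * s * e (b + i) ω) (fun i => ?_) n
    exact (measurable_pastAlgebra (by omega)).const_mul _
  have hs2 : s ^ 2 ≤ 1 / (256 * c ^ 2 * T) := by
    rw [← sq_abs]
    calc |s| ^ 2 ≤ (1 / (16 * c * √T)) ^ 2 := by gcongr
      _ = 1 / (256 * c ^ 2 * T) := by rw [div_pow, mul_pow, mul_pow, Real.sq_sqrt hT'.le]; norm_num
  have hcs : 2 * c * s ^ 2 ≤ 1 / (128 * c * T) := by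
    calc 2 * c * s ^ 2 ≤ 2 * c * (1 / (256 * c ^ 2 * T)) := by gcongr
      _ = 1 / (128 * c * T) := by field_simp; norm_num
  have hT1 : (1 : ℝ) ≤ T := by exact_mod_cast hT
  have hZm : expMoment μ Z ≤ ENNReal.ofReal (Real.exp 1) := by
    refine (hn.expMoment_sum_sq_le b n ?_).trans ?_
    · rw [abs_of_nonneg (by positivity)]
      refine hcs.trans ?_
      refine one_div_le_one_div_of_le (by positivity) ?_
      nlinarith
    · refine ENNReal.ofReal_le_ofReal (Real.exp_le_exp.2 ?_)
      calc 2048 * c ^ 2 * (2 * c * s ^ 2) ^ 2 * n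
          ≤ 2048 * c ^ 2 * (1 / (128 * c * T)) ^ 2 * T := by gcongr
        _ = 1 / 8 * (1 / (T : ℝ)) := by field_simp; norm_num
        _ ≤ 1 / 8 * 1 := by gcongr; exact (div_le_one hT').2 hT1
        _ ≤ 1 := by norm_num
  have hq1 : q ≤ 1 := by
    calc q ≤ 1 / (128 * c * T) * (T * c) := by
          rw [hq]
          have := hn.second_moment_nonneg
          have := hn.second_moment_le
          gcongr
      _ ≤ 1 := by field_simp; norm_num
  have hpt : ∀ ω, Real.exp (s * ∑ i ∈ Finset.range n, e (a + i) ω * e (b + i) ω) ≤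
      Real.exp (X ω) + Real.exp 1 * Real.exp (Z ω) := fun ω => by
    have h1 : s * ∑ i ∈ Finset.range n, e (a + i) ω * e (b + i) ω = X ω / 2 + (Z ω + q) / 2 := by
      rw [hX, hZ, hq]
      simp only [Finset.sum_sub_distrib, Finset.sum_const, Finset.card_range, nsmul_eq_mul, mul_pow]
      rw [← Finset.mul_sum, ← Finset.mul_sum]
      have : ∀ i, 2 * s * e (b + i) ω * e (a + i) ω = 2 * s * (e (a + i) ω * e (b + i) ω) :=
        fun i => by ring
      simp only [this]
      rw [← Finset.mul_sum]
      ring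
    rw [h1, ← Real.exp_add, Real.exp_add]
    rcases le_total (X ω) (Z ω + q) with h | h
    · calc Real.exp (X ω / 2) * Real.exp ((Z ω + q) / 2)
          = Real.exp (X ω / 2 + (Z ω + q) / 2) := (Real.exp_add _ _).symm
        _ ≤ Real.exp (1 + Z ω) := Real.exp_le_exp.2 (by linarith)
        _ ≤ _ := by linarith [Real.exp_pos (X ω)]
    · calc Real.exp (X ω / 2) * Real.exp ((Z ω + q) / 2)
          = Real.exp (X ω / 2 + (Z ω + q) / 2) := (Real.exp_add _ _).symm
        _ ≤ Real.exp (X ω) := Real.exp_le_exp.2 (by linarith)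
        _ ≤ _ := by linarith [Real.exp_pos (1 + Z ω)]
  have hXmeas : Measurable X := by
    refine Finset.measurable_sum _ fun i _ => ?_
    have := hm (a + i); have := hm (b + i); fun_prop
  calc expMoment μ (fun ω => s * ∑ i ∈ Finset.range n, e (a + i) ω * e (b + i) ω)
      ≤ ∫⁻ ω, (ENNReal.ofReal (Real.exp (X ω)) +
          ENNReal.ofReal (Real.exp 1) * ENNReal.ofReal (Real.exp (Z ω))) ∂μ := by
        refine lintegral_mono fun ω => (ENNReal.ofReal_le_ofReal (hpt ω)).trans (le_of_eq ?_)
        rw [ENNReal.ofReal_add (Real.exp_pos _).le (by positivity),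
          ENNReal.ofReal_mul (Real.exp_pos _).le]
    _ = expMoment μ X + ENNReal.ofReal (Real.exp 1) * expMoment μ Z := by
        rw [lintegral_add_left hXmeas.exp.ennreal_ofReal, lintegral_const_mul' _ _ (by simp)]
        rfl
    _ ≤ 1 + ENNReal.ofReal (Real.exp 1) * ENNReal.ofReal (Real.exp 1) := by gcongr
    _ ≤ ENNReal.ofReal (Real.exp 8) := by
        rw [← ENNReal.ofReal_one, ← ENNReal.ofReal_mul (Real.exp_pos _).le,
          ← ENNReal.ofReal_add (by norm_num) (by positivity), ← Real.exp_add]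
        refine ENNReal.ofReal_le_ofReal ?_
        have h2 : Real.exp 8 = Real.exp (1 + 1) * Real.exp 6 := by rw [← Real.exp_add]; norm_num
        have h3 := Real.add_one_le_exp (6 : ℝ)
        have h4 := Real.add_one_le_exp (1 + 1 : ℝ)
        rw [h2]
        nlinarith

/-- Exponential moments of the centered products of the noise at two times, summed over a
window. -/
theorem expMoment_lag_le [IsProbabilityMeasure μ] (a b : ℤ) {n T : ℕ} (hT : 0 < T) (hnT : n ≤ T)
    {s : ℝ} (hs : |s| ≤ 1 / (16 * c * √T)) :
    expMoment μ (fun ω => s * ∑ i ∈ Finset.range n,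
      (e (a + i) ω * e (b + i) ω - if a = b then v else 0)) ≤ ENNReal.ofReal (Real.exp 8) := by
  rcases lt_trichotomy a b with h | h | h
  · simp only [h.ne, if_false, sub_zero]
    simp only [mul_comm (e (a + _) _)]
    exact hn.expMoment_lag_lt_le h hT hnT hs
  · subst h
    simp only [if_true, ← sq]
    have hc := hn.proxy_pos
    have hT' : (0 : ℝ) < T := by exact_mod_cast hT
    have hnT' : (n : ℝ) ≤ T := by exact_mod_cast hnT
    have hT1 : (1 : ℝ) ≤ T := by exact_mod_cast hT
    refine (hn.expMoment_sum_sq_le a n (hs.trans ?_)).trans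
      (ENNReal.ofReal_le_ofReal (Real.exp_le_exp.2 ?_))
    · exact one_div_le_one_div_of_le (by positivity)
        (le_mul_of_one_le_right (by positivity) (Real.one_le_sqrt.2 hT1))
    -- The diagonal lag fixes the exponent `8 = 2048 / 16 ^ 2`.
    · calc 2048 * c ^ 2 * s ^ 2 * n ≤ 2048 * c ^ 2 * (1 / (16 * c * √T)) ^ 2 * T := by
            rw [← sq_abs s]; gcongr
        _ = 8 := by rw [div_pow, mul_pow, mul_pow, Real.sq_sqrt hT'.le]; field_simp; norm_num
  · simp only [h.ne', if_false, sub_zero]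
    exact hn.expMoment_lag_lt_le h hT hnT hs

end IsNoise

/-! ### Linear processes -/

/-- `X` is the linear process obtained by filtering `e` with the coefficients `g`. -/
def IsFiltered (μ : Measure Ω) (e : ℤ → Ω → ℝ) (g : ℕ → ℝ) (X : ℤ → Ω → ℝ) : Prop :=
  ∀ t, ∀ᵐ ω ∂μ, Filter.Tendsto (fun K => ∑ k ∈ Finset.range K, g k * e (t - k) ω)
    Filter.atTop (nhds (X t ω))

namespace IsNoise

variable (hn : IsNoise μ v c e)

include hn

theorem aemeasurable_of_isFiltered {g : ℕ → ℝ} {X : ℤ → Ω → ℝ} (hX : IsFiltered μ e g X) (t : ℤ) :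
    AEMeasurable (X t) μ :=
  aemeasurable_of_tendsto_metrizable_ae Filter.atTop (fun _ => (Finset.measurable_sum _ fun _ _ =>
    (hn.measurable _).const_mul _).aemeasurable) (hX t)

/-- Exponential moments of the empirical covariance of two linear processes. -/
theorem expMoment_filtered_mul_le [IsProbabilityMeasure μ] {g g' : ℕ → ℝ} {X X' : ℤ → Ω → ℝ}
    (hX : IsFiltered μ e g X) (hX' : IsFiltered μ e g' X') {H : ℝ}
    (hg : ∀ K, ∑ k ∈ Finset.range K, |g k| ≤ H) (hg' : ∀ K, ∑ k ∈ Finset.range K, |g' k| ≤ H)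
    {ρ : ℝ} (hρ : HasSum (fun k => g k * g' k) ρ) (a : ℤ) {n T : ℕ} (hT : 0 < T) (hnT : n ≤ T)
    {s : ℝ} (hs : |s| * H ^ 2 ≤ 1 / (16 * c * √T)) :
    expMoment μ (fun ω => s * (∑ i ∈ Finset.range n, X (a + i) ω * X' (a + i) ω - n * (v * ρ))) ≤
      ENNReal.ofReal (Real.exp 8) := by
  have hH : 0 ≤ H := by simpa using hg 0
  -- Truncating both filters at `K` makes the centered covariance a finite combination of centered
  -- lag sums. The weights `g k * g' l` have total mass at most `H ^ 2`, so Jensen applies uniformly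
  -- in `K`.
  set P : ℕ → Ω → ℝ := fun K ω => ∑ q ∈ Finset.range K ×ˢ Finset.range K, g q.1 * g' q.2 *
    ∑ i ∈ Finset.range n, (e (a - q.1 + i) ω * e (a - q.2 + i) ω -
      if a - q.1 = a - q.2 then v else 0) with hP
  have hWm : ∀ q : ℕ × ℕ, Measurable fun ω => ∑ i ∈ Finset.range n,
      (e (a - q.1 + i) ω * e (a - q.2 + i) ω - if a - (q.1 : ℤ) = a - q.2 then v else 0) :=
    fun q => Finset.measurable_sum _ fun i _ =>
      ((hn.measurable _).mul (hn.measurable _)).sub measurable_const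
  have hPK : ∀ K, expMoment μ (fun ω => s * P K ω) ≤ ENNReal.ofReal (Real.exp 8) := fun K => by
    refine expMoment_sum_le _ _ _ hWm ?_ (s₁ := 1 / (16 * c * √T)) ?_ ?_
    · rw [← ENNReal.ofReal_one]
      exact ENNReal.ofReal_le_ofReal (Real.one_le_exp (by norm_num))
    · exact fun q _ s hs => hn.expMoment_lag_le _ _ hT hnT hs
    · refine le_trans ?_ hs
      gcongr
      rw [Finset.sum_product]
      simp only [abs_mul]
      rw [← Finset.sum_mul_sum, sq]
      exact mul_le_mul (hg K) (hg' K) (Finset.sum_nonneg fun _ _ => abs_nonneg _) hH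
  have hPeq : ∀ K ω, P K ω = ∑ i ∈ Finset.range n,
      (∑ k ∈ Finset.range K, g k * e (a + i - k) ω) *
        (∑ k ∈ Finset.range K, g' k * e (a + i - k) ω) -
      n * (v * ∑ k ∈ Finset.range K, g k * g' k) := fun K ω => by
    have h1 : ∀ q : ℕ × ℕ, (g q.1 * g' q.2 * ∑ i ∈ Finset.range n,
        (e (a - q.1 + i) ω * e (a - q.2 + i) ω - if a - (q.1 : ℤ) = a - q.2 then v else 0)) =
        ∑ i ∈ Finset.range n, (g q.1 * e (a + i - q.1) ω) * (g' q.2 * e (a + i - q.2) ω) -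
        n * (if q.1 = q.2 then v * (g q.1 * g' q.2) else 0) := fun q => by
      rw [Finset.sum_sub_distrib, Finset.sum_const, Finset.card_range, nsmul_eq_mul, mul_sub,
        Finset.mul_sum]
      congr 1
      · refine Finset.sum_congr rfl fun i _ => ?_
        rw [sub_add_eq_add_sub, sub_add_eq_add_sub]; ring
      · simp only [sub_right_inj, Nat.cast_inj]
        split_ifs <;> ring
    rw [hP]
    simp only [h1]
    rw [Finset.sum_sub_distrib, Finset.sum_comm, ← Finset.mul_sum]
    congr 1
    · refine Finset.sum_congr rfl fun i _ => ?_
      rw [Finset.sum_product, Finset.sum_mul_sum]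
    · congr 1
      rw [Finset.sum_product, Finset.mul_sum]
      refine Finset.sum_congr rfl fun k hk => ?_
      simp only
      rw [Finset.sum_ite_eq, if_pos hk]
  refine expMoment_le_of_tendsto (X := fun K ω => s * P K ω) (fun K => ?_) hPK ?_
  · exact (Finset.measurable_sum _ fun q _ => (hWm q).const_mul _).const_mul _
  · have hall : ∀ᵐ ω ∂μ, ∀ t, Filter.Tendsto
        (fun K => ∑ k ∈ Finset.range K, g k * e (t - k) ω) Filter.atTop (nhds (X t ω)) :=
      ae_all_iff.2 hX
    have hall' : ∀ᵐ ω ∂μ, ∀ t, Filter.Tendsto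
        (fun K => ∑ k ∈ Finset.range K, g' k * e (t - k) ω) Filter.atTop (nhds (X' t ω)) :=
      ae_all_iff.2 hX'
    filter_upwards [hall, hall'] with ω h1 h2
    simp only [hPeq]
    exact ((tendsto_finsetSum _ fun i _ => (h1 _).mul (h2 _)).sub
      ((hρ.tendsto_sum_nat.const_mul v).const_mul _)).const_mul s

/-- Exponential moments of the sum of the products of a linear process with the next noise
variables. -/
theorem expMoment_filtered_noise_le [IsProbabilityMeasure μ] {g : ℕ → ℝ} {X : ℤ → Ω → ℝ}
    (hX : IsFiltered μ e g X) (a : ℤ) (n : ℕ) (s : ℝ) :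
    expMoment μ (fun ω => ∑ i ∈ Finset.range n,
      (s * X (a + i) ω * e (a + 1 + i) ω - c / 2 * (s * X (a + i) ω) ^ 2)) ≤ 1 := by
  -- Only the truncated filters are known to be measurable for the past itself, so the
  -- supermartingale bound is applied to them and then passed to the limit.
  have hm : ∀ (K : ℕ) (t t' : ℤ), t < t' → Measurable[pastAlgebra e t']
      fun ω => s * ∑ k ∈ Finset.range K, g k * e (t - k) ω := fun K t t' h =>
    (Finset.measurable_sum _ fun k _ => (measurable_pastAlgebra (by omega)).const_mul _).const_mul _
  refine expMoment_le_of_tendsto (X := fun K ω => ∑ i ∈ Finset.range n,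
      (s * (∑ k ∈ Finset.range K, g k * e (a + i - k) ω) * e (a + 1 + i) ω -
        c / 2 * (s * (∑ k ∈ Finset.range K, g k * e (a + i - k) ω)) ^ 2)) (fun K => ?_)
    (fun K => ?_) ?_
  · refine Finset.measurable_sum _ fun i _ => ?_
    have h1 := (hm K (a + i) (a + i + 1) (by omega)).mono (hn.pastAlgebra_le _) le_rfl
    exact (h1.mul (hn.measurable _)).sub ((h1.pow_const 2).const_mul _)
  · exact hn.expMoment_predictable_le (a + 1) _ (fun i => hm K (a + i) _ (by omega)) n
  · have hall : ∀ᵐ ω ∂μ, ∀ t, Filter.Tendsto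
        (fun K => ∑ k ∈ Finset.range K, g k * e (t - k) ω) Filter.atTop (nhds (X t ω)) :=
      ae_all_iff.2 hX
    filter_upwards [hall] with ω h
    exact tendsto_finsetSum _ fun i _ => (((h _).const_mul s).mul_const _).sub
      ((((h _).const_mul s).pow 2).const_mul _)

end IsNoise

end Noise

/-! ### Stationary solutions of the autoregressive recursion are linear processes -/

section Stationary

variable {p : ℕ} [NeZero p] (α : EuclideanSpace ℝ (Fin p))

/-- Downward induction on the column: the last column is a delayed multiple of the impulse response,
and each earlier one adds such a multiple to its right neighbour, delayed by one. -/
theorem summable_abs_companion_pow_zero (h : Summable fun k => |impulse α k|) (j : Fin p) :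
    Summable fun k => |(companion α ^ k) 0 j| := by
  obtain ⟨m, hm⟩ : ∃ m, m = p - 1 - (j : ℕ) := ⟨_, rfl⟩
  induction m generalizing j with
  | zero =>
    rw [← summable_nat_add_iff 1]
    have hj : ¬ ((j : ℕ) + 1 < p) := by omega
    simp only [companion_pow_succ_zero, hj, dif_neg, not_false_eq_true, add_zero, abs_mul]
    exact h.mul_right _
  | succ m ih =>
    rw [← summable_nat_add_iff 1]
    have hj : (j : ℕ) + 1 < p := by omega
    simp only [companion_pow_succ_zero, hj, dif_pos]
    refine Summable.of_nonneg_of_le (fun _ => abs_nonneg _) (fun _ => abs_add_le _ _) ?_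
    simp only [abs_mul]
    exact (h.mul_right _).add (ih ⟨j + 1, hj⟩ (by simp; omega))

/-- Unrolling the recursion `K` times. -/
theorem eq_sum_impulse_add_remainder {x e : ℤ → ℝ}
    (hrec : ∀ t, x t = ∑ i : Fin p, α i * x (t - ((i : ℕ) + 1)) + e t) (K : ℕ) (t : ℤ) :
    x t = ∑ k ∈ Finset.range K, impulse α k * e (t - k) +
      ∑ j : Fin p, (companion α ^ K) 0 j * x (t - K - (j : ℕ)) := by
  have hstate : ∀ t : ℤ, (fun j : Fin p => x (t - (j : ℕ))) =
      (companion α).mulVec (fun j : Fin p => x (t - 1 - (j : ℕ))) + e t • inputVec p := fun t => by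
    ext j
    simp only [Pi.add_apply, Pi.smul_apply, smul_eq_mul, Matrix.mulVec, dotProduct]
    by_cases hj : (j : ℕ) = 0
    · simp only [companion, Matrix.of_apply, hj, inputVec, if_true]
      simp only [Nat.cast_zero, sub_zero, mul_one]
      rw [hrec t]
      congr 1
      refine Finset.sum_congr rfl fun i _ => ?_
      congr 2; ring
    · rw [Finset.sum_eq_single ⟨(j : ℕ) - 1, by omega⟩]
      · have : (j : ℕ) = (j : ℕ) - 1 + 1 := by omega
        simp only [companion, Matrix.of_apply, if_neg hj, inputVec, if_pos this, one_mul, mul_zero,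
          add_zero]
        congr 1
        omega
      · intro i _ hi
        have : (j : ℕ) ≠ (i : ℕ) + 1 := fun h => hi (Fin.ext (by simp; omega))
        simp only [companion, Matrix.of_apply, if_neg hj, if_neg this, zero_mul]
      · simp
  induction K with
  | zero => simp [Matrix.one_apply]
  | succ K ih =>
    have h1 : ∀ (K : ℕ) (s : ℤ), ∑ j : Fin p, (companion α ^ K) 0 j * x (s - (j : ℕ)) =
        (companion α ^ K).mulVec (fun j : Fin p => x (s - (j : ℕ))) 0 := fun _ _ => rfl
    rw [ih, Finset.sum_range_succ, h1, h1, hstate (t - K), Matrix.mulVec_add, Matrix.mulVec_smul,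
      Matrix.mulVec_mulVec, ← pow_succ, Pi.add_apply, Pi.smul_apply, companion_pow_mulVec_inputVec,
      smul_eq_mul]
    have h2 : t - ((K + 1 : ℕ) : ℤ) = t - K - 1 := by push_cast; ring
    have h3 : stateImpulse α 0 K = impulse α K := rfl
    rw [h2, h3]
    ring

variable {Ω : Type*} [MeasurableSpace Ω] {μ : Measure Ω}

/-- The series of the terms has finite expected absolute sum, hence converges absolutely almost
surely, and its terms tend to zero. -/
theorem ae_tendsto_mul_zero {a : ℕ → ℝ} (ha : Summable fun k => |a k|) {f : ℕ → Ω → ℝ}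
    (hf : ∀ k, AEStronglyMeasurable (f k) μ) {D : ℝ≥0} (hD : ∀ k, ∫⁻ ω, ‖f k ω‖ₑ ∂μ ≤ D) :
    ∀ᵐ ω ∂μ, Filter.Tendsto (fun k => a k * f k ω) Filter.atTop (nhds 0) := by
  have h1 : ∫⁻ ω, ∑' k, ‖a k * f k ω‖ₑ ∂μ ≠ ⊤ := by
    rw [lintegral_tsum fun k => (((hf k).const_mul (a k)).enorm)]
    have h2 : ∀ k, ∫⁻ ω, ‖a k * f k ω‖ₑ ∂μ ≤ ENNReal.ofReal |a k| * D := fun k => by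
      simp only [enorm_mul]
      rw [lintegral_const_mul' _ _ (by simp), ← Real.enorm_eq_ofReal_abs]
      gcongr
      exact hD k
    refine ne_top_of_le_ne_top ?_ (ENNReal.tsum_le_tsum h2)
    rw [ENNReal.tsum_mul_right]
    exact ENNReal.mul_ne_top ha.tsum_ofReal_ne_top (by simp)
  have hm : AEMeasurable (fun ω => ∑' k, ‖a k * f k ω‖ₑ) μ :=
    AEMeasurable.tsum fun k => ((hf k).const_mul (a k)).enorm
  filter_upwards [ae_lt_top' hm h1] with ω hω
  have h3 := ENNReal.tendsto_atTop_zero_of_tsum_ne_top hω.ne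
  rw [tendsto_zero_iff_norm_tendsto_zero]
  have h4 := (ENNReal.tendsto_toReal (a := 0) (by simp)).comp h3
  simpa [Function.comp_def] using h4

/-- A solution of the recursion with bounded first absolute moments is the response to the noise. -/
theorem isFiltered_of_recursion (hs : Summable fun k => |impulse α k|) {x e : ℤ → Ω → ℝ}
    (hx : ∀ t, AEStronglyMeasurable (x t) μ) {D : ℝ≥0} (hD : ∀ t, ∫⁻ ω, ‖x t ω‖ₑ ∂μ ≤ D)
    (hrec : ∀ t, ∀ᵐ ω ∂μ, x t ω = ∑ i : Fin p, α i * x (t - ((i : ℕ) + 1)) ω + e t ω) :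
    IsFiltered μ e (impulse α) x := by
  intro t
  have hR : ∀ᵐ ω ∂μ, ∀ j : Fin p, Filter.Tendsto
      (fun K : ℕ => (companion α ^ K) 0 j * x (t - K - (j : ℕ)) ω) Filter.atTop (nhds 0) :=
    ae_all_iff.2 fun j => ae_tendsto_mul_zero (summable_abs_companion_pow_zero α hs j)
      (fun _ => hx _) fun _ => hD _
  filter_upwards [ae_all_iff.2 hrec, hR] with ω h1 h2
  have h3 : ∀ K, ∑ k ∈ Finset.range K, impulse α k * e (t - k) ω =
      x t ω - ∑ j : Fin p, (companion α ^ K) 0 j * x (t - K - (j : ℕ)) ω := fun K => by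
    rw [eq_sub_iff_add_eq]
    exact (eq_sum_impulse_add_remainder α (x := fun t => x t ω) (e := fun t => e t ω) h1 K t).symm
  simp only [h3]
  have h4 := (tendsto_const_nhds (x := x t ω)).sub (tendsto_finsetSum Finset.univ fun j _ => h2 j)
  simpa using h4

theorem isFiltered_stateImpulse {x e : ℤ → Ω → ℝ} (h : IsFiltered μ e (impulse α) x)
    (i : Fin p) : IsFiltered μ e (stateImpulse α i) (fun t => x (t - (i : ℕ))) := by
  intro t
  filter_upwards [h (t - (i : ℕ))] with ω hω
  rw [← Filter.tendsto_add_atTop_iff_nat (i : ℕ)]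
  refine hω.congr fun K => ?_
  rw [add_comm K, Finset.sum_range_add]
  have h1 : ∑ k ∈ Finset.range (i : ℕ), stateImpulse α i k * e (t - k) ω = 0 := by
    refine Finset.sum_eq_zero fun k hk => ?_
    rw [stateImpulse_eq, if_neg (by have := Finset.mem_range.1 hk; omega), zero_mul]
  rw [h1, zero_add]
  refine Finset.sum_congr rfl fun k _ => ?_
  rw [stateImpulse_eq, if_pos (by omega), Nat.add_sub_cancel_left]
  push_cast
  rw [sub_sub]

/-- Projections of the state are again linear processes, which the martingale bound needs for the
whitened directions. -/
theorem IsFiltered.sum {ι : Type*} [Fintype ι] {e : ℤ → Ω → ℝ} {g : ι → ℕ → ℝ}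
    {X : ι → ℤ → Ω → ℝ} (h : ∀ i, IsFiltered μ e (g i) (X i)) (v : ι → ℝ) :
    IsFiltered μ e (fun k => ∑ i, v i * g i k) (fun t ω => ∑ i, v i * X i t ω) := by
  intro t
  filter_upwards [ae_all_iff.2 fun i => h i t] with ω hω
  refine (tendsto_finsetSum Finset.univ fun i _ => (hω i).const_mul (v i)).congr fun K => ?_
  simp only [Finset.mul_sum, Finset.sum_mul]
  rw [Finset.sum_comm]
  exact Finset.sum_congr rfl fun _ _ => Finset.sum_congr rfl fun _ _ => by ring

theorem exists_lintegral_enorm_le [IsProbabilityMeasure μ] {x : ℤ → Ω → ℝ}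
    (hx : ∀ t, MemLp (x t) 2 μ) (hmean : ∀ t s, ∫ ω, x t ω ∂μ = ∫ ω, x s ω ∂μ)
    (hvar : ∀ t s, variance (x t) μ = variance (x s) μ) :
    ∃ D : ℝ≥0, ∀ t, ∫⁻ ω, ‖x t ω‖ₑ ∂μ ≤ D := by
  have h2 : ∀ t, ∫ ω, x t ω ^ 2 ∂μ = ∫ ω, x 0 ω ^ 2 ∂μ := fun t => by
    have h := hvar t 0
    rw [variance_eq_sub (hx t), variance_eq_sub (hx 0), hmean t 0] at h
    simpa using h
  refine ⟨Real.toNNReal (1 + ∫ ω, x 0 ω ^ 2 ∂μ), fun t => ?_⟩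
  have hi : Integrable (x t) μ := (hx t).integrable (by norm_num)
  rw [← ofReal_integral_norm_eq_lintegral_enorm hi]
  refine ENNReal.ofReal_le_ofReal ?_
  rw [← h2 t]
  have h3 : ∫ ω, (1 + x t ω ^ 2) ∂μ = 1 + ∫ ω, x t ω ^ 2 ∂μ := by
    rw [integral_add (integrable_const _) (hx t).integrable_sq]; simp
  rw [← h3]
  refine integral_mono hi.norm ((integrable_const _).add (hx t).integrable_sq) fun ω => ?_
  simp only [Real.norm_eq_abs]
  nlinarith [sq_abs (x t ω), sq_nonneg (|x t ω| - 1)]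

end Stationary

namespace ARFamily.IsStationaryAR

variable {N : ℕ} {M : ARFamily N} {Ω : Type*} [MeasurableSpace Ω] {μ : Measure Ω}
  [IsProbabilityMeasure μ] {σ κ : ℝ} {η x : Fin N → ℤ → Ω → ℝ}

theorem isNoise (h : M.IsStationaryAR σ κ μ η x) (hσ : 0 < σ) (hκ : 1 ≤ κ) (n : Fin N) :
    IsNoise μ (σ ^ 2) (κ * σ ^ 2) (η n) where
  measurable := h.measurable_noise n
  indep := h.indep.precomp (g := fun t => (n, t)) fun _ _ h => (Prod.mk.inj h).2
  proxy_pos := by positivity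
  second_moment_nonneg := by positivity
  second_moment_le := le_mul_of_one_le_left (by positivity) hκ
  integrable_sq t := ((h.subgaussian n t).memLp 2).integrable_sq
  second_moment t := by
    rw [← h.variance_eq n t, variance_eq_sub ((h.subgaussian n t).memLp 2), h.mean_zero]
    simp
  expMoment_le t s := by
    have h1 := (h.subgaussian n t).mgf_le s
    rw [Real.coe_toNNReal _ (by positivity), mgf,
      integral_eq_lintegral_of_nonneg_ae (Filter.Eventually.of_forall fun _ => (Real.exp_pos _).le)
      ((h.subgaussian n t).integrable_exp_mul s).aestronglyMeasurable] at h1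
    have h2 := ((h.subgaussian n t).integrable_exp_mul s).lintegral_lt_top
    exact (ENNReal.le_ofReal_iff_toReal_le h2.ne (Real.exp_pos _).le).2 h1

theorem isFiltered (h : M.IsStationaryAR σ κ μ η x) (n : Fin N) [NeZero (M.p n)]
    (hs : Summable fun k => |impulse (M.α n) k|) : IsFiltered μ (η n) (impulse (M.α n)) (x n) := by
  -- Stationarity is needed only to bound the first absolute moments uniformly in time; the
  -- covariance condition enters at lag zero.
  obtain ⟨D, hD⟩ := exists_lintegral_enorm_le (h.memLp n) (h.mean_const n) fun t s => by
    have := h.cov_shift n t s 0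
    simp only [add_zero] at this
    rwa [covariance_self (h.memLp n t).aestronglyMeasurable.aemeasurable,
      covariance_self (h.memLp n s).aestronglyMeasurable.aemeasurable] at this
  exact isFiltered_of_recursion _ hs (fun t => (h.memLp n t).aestronglyMeasurable) hD
    (h.recursion n)

end ARFamily.IsStationaryAR

/-! ### Least squares with perturbed regressors -/

section LeastSquares

variable {p T : ℕ}

theorem sq_sum_mul_le (v : EuclideanSpace ℝ (Fin p)) (f : Fin p → ℝ) :
    (∑ i, v i * f i) ^ 2 ≤ ‖v‖ ^ 2 * ∑ i, f i ^ 2 := by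
  rw [EuclideanSpace.real_norm_sq_eq]
  exact Finset.sum_mul_sq_le_sq_mul_sq _ _ _

/-- For each lag `i < p` the map `t ↦ t - i` is injective from `[p, T)` into `[1, T]`; since `t ≥
p`, the natural subtraction does not truncate. -/
theorem sum_lag_sq_le (δ : ℕ → ℝ) :
    ∑ t ∈ Finset.Ico p T, ∑ i : Fin p, δ (t - (i : ℕ)) ^ 2 ≤
      p * ∑ t ∈ Finset.Icc 1 T, δ t ^ 2 := by
  rw [Finset.sum_comm]
  refine (Finset.sum_le_card_nsmul Finset.univ _ (∑ t ∈ Finset.Icc 1 T, δ t ^ 2)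
    fun i _ => ?_).trans (by simp)
  have hi := i.2
  rw [← Finset.sum_image (s := Finset.Ico p T) (g := fun t => t - (i : ℕ))
    (f := fun t => δ t ^ 2) (fun a ha b hb hab => by
      simp only [Finset.coe_Ico, Set.mem_Ico] at ha hb
      simp only at hab
      omega)]
  refine Finset.sum_le_sum_of_subset_of_nonneg (fun t ht => ?_) fun _ _ _ => sq_nonneg _
  simp only [Finset.mem_image, Finset.mem_Ico] at ht
  obtain ⟨s, hs, rfl⟩ := ht
  simp only [Finset.mem_Icc]
  omega

theorem sum_succ_sq_le (δ : ℕ → ℝ) :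
    ∑ t ∈ Finset.Ico p T, δ (t + 1) ^ 2 ≤ ∑ t ∈ Finset.Icc 1 T, δ t ^ 2 := by
  rw [← Finset.sum_image (s := Finset.Ico p T) (g := fun t => t + 1)
    (f := fun t => δ t ^ 2) (fun a _ b _ hab => by simpa using hab)]
  refine Finset.sum_le_sum_of_subset_of_nonneg (fun t ht => ?_) fun _ _ _ => sq_nonneg _
  simp only [Finset.mem_image, Finset.mem_Ico] at ht
  obtain ⟨s, hs, rfl⟩ := ht
  simp only [Finset.mem_Icc]
  omega

theorem sum_sq_le_two_mul_of_sum_sub_sq_le {ι : Type*} {I : Finset ι} {r ζ : ι → ℝ}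
    (h : ∑ t ∈ I, (r t - ζ t) ^ 2 ≤ ∑ t ∈ I, r t ^ 2) :
    ∑ t ∈ I, ζ t ^ 2 ≤ 2 * ∑ t ∈ I, ζ t * r t := by
  have h1 : ∑ t ∈ I, (r t - ζ t) ^ 2 =
      ∑ t ∈ I, r t ^ 2 - 2 * ∑ t ∈ I, ζ t * r t + ∑ t ∈ I, ζ t ^ 2 := by
    rw [Finset.mul_sum, ← Finset.sum_sub_distrib, ← Finset.sum_add_distrib]
    exact Finset.sum_congr rfl fun t _ => by ring
  linarith

/-- Error of the least squares estimate when the trajectory `ξ` of the recursion is only observed up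
to a perturbation `δ`. The matrix `P` is, up to the factor `m`, a lower bound for the Gram matrix of
the lagged trajectory. -/
theorem norm_sub_sq_le_of_isOLS {α a : EuclideanSpace ℝ (Fin p)} {ξ ε δ z : ℕ → ℝ}
    (hz : ∀ t, z t = ξ t - δ t)
    (hrec : ∀ t ∈ Finset.Ico p T, ξ (t + 1) = ∑ i : Fin p, α i * ξ (t - (i : ℕ)) + ε (t + 1))
    {P : Matrix (Fin p) (Fin p) ℝ} {m ψ A B : ℝ} (hm : 0 < m) (hψ : 0 < ψ)
    (hP : ∀ v : EuclideanSpace ℝ (Fin p), ψ * ‖v‖ ^ 2 ≤ (v : Fin p → ℝ) ⬝ᵥ P.mulVec v)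
    (hlow : ∀ v : EuclideanSpace ℝ (Fin p), m / 4 * ((v : Fin p → ℝ) ⬝ᵥ P.mulVec v) ≤
      ∑ t ∈ Finset.Ico p T, (∑ i : Fin p, v i * ξ (t - (i : ℕ))) ^ 2)
    (hmart : ∀ v : EuclideanSpace ℝ (Fin p),
      ∑ t ∈ Finset.Ico p T, (∑ i : Fin p, v i * ξ (t - (i : ℕ))) * ε (t + 1) ≤
        √((v : Fin p → ℝ) ⬝ᵥ P.mulVec v) * √A)
    (hA : 0 ≤ A) (hB : ∑ t ∈ Finset.Ico p T, ε (t + 1) ^ 2 ≤ B)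
    (hδ : p * ∑ t ∈ Finset.Icc 1 T, δ t ^ 2 ≤ m * ψ / 6) (ha : IsOLS T z a) :
    ‖a - α‖ ^ 2 ≤ 1000000 / (m * ψ) * (A / m + p * (∑ t ∈ Finset.Icc 1 T, δ t ^ 2) * B / (m * ψ) +
      (‖α‖ ^ 2 * p + 1) * ∑ t ∈ Finset.Icc 1 T, δ t ^ 2) := by
  set S := ∑ t ∈ Finset.Icc 1 T, δ t ^ 2 with hS
  have hS0 : 0 ≤ S := Finset.sum_nonneg fun _ _ => sq_nonneg _
  have hB0 : 0 ≤ B := (Finset.sum_nonneg fun _ _ => sq_nonneg _).trans hB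
  set I := Finset.Ico p T with hI
  set v := a - α with hv
  set q := (v : Fin p → ℝ) ⬝ᵥ P.mulVec v with hq
  set xv : ℕ → ℝ := fun t => ∑ i : Fin p, v i * ξ (t - (i : ℕ)) with hxv
  set dv : ℕ → ℝ := fun t => ∑ i : Fin p, v i * δ (t - (i : ℕ)) with hdv
  -- The residual of the perturbed data at the true `α` is `ε (t + 1) + w t`.
  set w : ℕ → ℝ := fun t => ∑ i : Fin p, α i * δ (t - (i : ℕ)) - δ (t + 1) with hw
  have hqv : ψ * ‖v‖ ^ 2 ≤ q := hP v
  have hq0 : 0 ≤ q := le_trans (by positivity) hqv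
  have hlag : ∀ u : EuclideanSpace ℝ (Fin p),
      ∑ t ∈ I, (∑ i : Fin p, u i * δ (t - (i : ℕ))) ^ 2 ≤ ‖u‖ ^ 2 * (p * S) := fun u => by
    refine (Finset.sum_le_sum fun t _ => sq_sum_mul_le u fun i => δ (t - (i : ℕ))).trans ?_
    rw [← Finset.mul_sum]
    gcongr
    exact sum_lag_sq_le δ
  have hdv2 : ∑ t ∈ I, dv t ^ 2 ≤ ‖v‖ ^ 2 * (p * S) := hlag v
  have hw2 : ∑ t ∈ I, w t ^ 2 ≤ 2 * ((‖α‖ ^ 2 * p + 1) * S) := by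
    calc ∑ t ∈ I, w t ^ 2
        ≤ ∑ t ∈ I, (2 * (∑ i : Fin p, α i * δ (t - (i : ℕ))) ^ 2 + 2 * δ (t + 1) ^ 2) := by
          refine Finset.sum_le_sum fun t _ => ?_
          nlinarith [sq_nonneg (∑ i : Fin p, α i * δ (t - (i : ℕ)) + δ (t + 1))]
      _ ≤ 2 * (‖α‖ ^ 2 * (p * S)) + 2 * S := by
          rw [Finset.sum_add_distrib, ← Finset.mul_sum, ← Finset.mul_sum]
          gcongr
          · exact hlag α
          · exact sum_succ_sq_le δ
      _ = _ := by ring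
  have hbasic : ∑ t ∈ I, (xv t - dv t) ^ 2 ≤
      2 * ∑ t ∈ I, (xv t - dv t) * (ε (t + 1) + w t) := by
    refine sum_sq_le_two_mul_of_sum_sub_sq_le ?_
    have hres : ∀ u : EuclideanSpace ℝ (Fin p), olsLoss T z u =
        ∑ t ∈ I, (ε (t + 1) + w t - ∑ i : Fin p, (u - α) i * (ξ (t - (i : ℕ)) - δ (t - (i : ℕ)))) ^ 2 :=
      fun u => by
        rw [olsLoss]
        refine Finset.sum_congr rfl fun t ht => ?_
        congr 1
        simp only [hz, hrec t ht, hw, PiLp.sub_apply, sub_mul, mul_sub, Finset.sum_sub_distrib]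
        ring
    have h := ha α
    rw [hres a, hres α] at h
    simpa [hxv, hdv, hv, mul_sub, Finset.sum_sub_distrib] using h
  set R := ∑ t ∈ I, (xv t - dv t) ^ 2 with hR
  -- The perturbation energy is at most `m q / 6` against a signal of at least `m q / 4`. The
  -- inequality `(x - d)² ≥ x² / 6 - d² / 5` leaves `1 / 24 - 1 / 30 = 1 / 120`.
  have hRlow : m / 120 * q ≤ R := by
    have h1 : ∑ t ∈ I, (xv t ^ 2 / 6 - dv t ^ 2 / 5) ≤ R :=
      Finset.sum_le_sum fun t _ => by nlinarith [sq_nonneg (5 * xv t - 6 * dv t)]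
    rw [Finset.sum_sub_distrib, ← Finset.sum_div, ← Finset.sum_div] at h1
    have h2 := hlow v
    have h3 : ‖v‖ ^ 2 * (p * S) ≤ m / 6 * q := by
      calc ‖v‖ ^ 2 * (p * S) ≤ ‖v‖ ^ 2 * (m * ψ / 6) := by gcongr
        _ = m / 6 * (ψ * ‖v‖ ^ 2) := by ring
        _ ≤ m / 6 * q := by gcongr
    linarith
  have hsplit : ∑ t ∈ I, (xv t - dv t) * (ε (t + 1) + w t) =
      ∑ t ∈ I, xv t * ε (t + 1) + ∑ t ∈ I, (-dv t) * ε (t + 1) +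
        ∑ t ∈ I, (xv t - dv t) * w t := by
    rw [← Finset.sum_add_distrib, ← Finset.sum_add_distrib]
    exact Finset.sum_congr rfl fun t _ => by ring
  have hw3 : ∑ t ∈ I, (xv t - dv t) * w t ≤ R / 4 + 2 * ((‖α‖ ^ 2 * p + 1) * S) := by
    calc ∑ t ∈ I, (xv t - dv t) * w t ≤ ∑ t ∈ I, ((xv t - dv t) ^ 2 / 4 + w t ^ 2) :=
          Finset.sum_le_sum fun t _ => by nlinarith [sq_nonneg ((xv t - dv t) / 2 - w t)]
      _ ≤ _ := by
          rw [Finset.sum_add_distrib, ← Finset.sum_div]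
          gcongr
  -- The weight `1 / 3840` is small enough for two such terms, doubled by the basic inequality, to
  -- leave `m q / 320` out of the `m q / 240` supplied by `R / 2`.
  have amgm : ∀ b : ℝ, 0 ≤ b → √q * √b ≤ m / 3840 * q + 960 * b / m := fun b hb => by
    have h1 := Real.sq_sqrt hq0
    have h2 := Real.sq_sqrt hb
    have h3 : m / 3840 * q + 960 * b / m - √q * √b = (m * √q - 1920 * √b) ^ 2 / (3840 * m) := by
      rw [← h1, ← h2, Real.sqrt_sq (Real.sqrt_nonneg _), Real.sqrt_sq (Real.sqrt_nonneg _)]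
      field_simp
      ring
    have h4 : 0 ≤ (m * √q - 1920 * √b) ^ 2 / (3840 * m) := by positivity
    linarith
  have hx3 : ∑ t ∈ I, xv t * ε (t + 1) ≤ m / 3840 * q + 960 * A / m :=
    (hmart v).trans (amgm A hA)
  -- The perturbation may depend on the noise, so there is no cancellation to exploit and
  -- Cauchy-Schwarz is used.
  have hd3 : ∑ t ∈ I, (-dv t) * ε (t + 1) ≤ m / 3840 * q + 960 * (p * S * B / ψ) / m := by
    refine ((Real.sum_mul_le_sqrt_mul_sqrt _ _ _).trans ?_).trans (amgm _ (by positivity))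
    rw [← Real.sqrt_mul (Finset.sum_nonneg fun _ _ => sq_nonneg _), ← Real.sqrt_mul hq0]
    refine Real.sqrt_le_sqrt ?_
    simp only [neg_sq]
    calc (∑ t ∈ I, dv t ^ 2) * ∑ t ∈ I, ε (t + 1) ^ 2 ≤ (‖v‖ ^ 2 * (p * S)) * B := by
          gcongr
      _ = (ψ * ‖v‖ ^ 2) * (p * S * B / ψ) := by field_simp
      _ ≤ q * (p * S * B / ψ) := by gcongr
  have hfin : m / 320 * q ≤ 1920 * (A / m + p * S * B / (m * ψ) + (‖α‖ ^ 2 * p + 1) * S) := by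
    have e1 : 960 * (p * S * B / ψ) / m = 960 * (p * S * B / (m * ψ)) := by field_simp
    have e2 : 960 * A / m = 960 * (A / m) := by ring
    have n1 : 0 ≤ A / m := by positivity
    have n2 : 0 ≤ p * S * B / (m * ψ) := by positivity
    have n3 : 0 ≤ (‖α‖ ^ 2 * p + 1) * S := by positivity
    rw [e1] at hd3
    rw [e2] at hx3
    rw [hsplit] at hbasic
    linarith
  have hX0 : 0 ≤ A / m + p * S * B / (m * ψ) + (‖α‖ ^ 2 * p + 1) * S := by positivity
  rw [div_mul_eq_mul_div, le_div_iff₀ (by positivity)]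
  have := mul_le_mul_of_nonneg_left hqv hm.le
  linarith

/-- Entrywise accuracy of the Gram matrix implies accuracy of the quadratic form. -/
theorem abs_sum_sq_sub_le {ξ : ℕ → ℝ} {P : Matrix (Fin p) (Fin p) ℝ} {r u : ℝ}
    (h : ∀ i j : Fin p,
      |∑ t ∈ Finset.Ico p T, ξ (t - (i : ℕ)) * ξ (t - (j : ℕ)) - r * P i j| ≤ u)
    (v : EuclideanSpace ℝ (Fin p)) :
    |∑ t ∈ Finset.Ico p T, (∑ i : Fin p, v i * ξ (t - (i : ℕ))) ^ 2 -
      r * ((v : Fin p → ℝ) ⬝ᵥ P.mulVec v)| ≤ p * u * ‖v‖ ^ 2 := by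
  have h1 : ∑ t ∈ Finset.Ico p T, (∑ i : Fin p, v i * ξ (t - (i : ℕ))) ^ 2 -
      r * ((v : Fin p → ℝ) ⬝ᵥ P.mulVec v) = ∑ i, ∑ j, v i * v j *
        (∑ t ∈ Finset.Ico p T, ξ (t - (i : ℕ)) * ξ (t - (j : ℕ)) - r * P i j) := by
    have e1 : ∑ t ∈ Finset.Ico p T, (∑ i : Fin p, v i * ξ (t - (i : ℕ))) ^ 2 =
        ∑ i, ∑ j, v i * v j * ∑ t ∈ Finset.Ico p T, ξ (t - (i : ℕ)) * ξ (t - (j : ℕ)) := by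
      simp only [sq, Finset.sum_mul_sum]
      rw [Finset.sum_comm]
      refine Finset.sum_congr rfl fun i _ => ?_
      rw [Finset.sum_comm]
      simp only [Finset.mul_sum]
      exact Finset.sum_congr rfl fun j _ => Finset.sum_congr rfl fun t _ => by ring
    have e2 : r * ((v : Fin p → ℝ) ⬝ᵥ P.mulVec v) = ∑ i, ∑ j, v i * v j * (r * P i j) := by
      simp only [dotProduct, Matrix.mulVec, Finset.mul_sum]
      exact Finset.sum_congr rfl fun i _ => Finset.sum_congr rfl fun j _ => by ring
    rw [e1, e2, ← Finset.sum_sub_distrib]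
    refine Finset.sum_congr rfl fun i _ => ?_
    rw [← Finset.sum_sub_distrib]
    exact Finset.sum_congr rfl fun j _ => by ring
  rcases Nat.eq_zero_or_pos p with rfl | hp
  · rw [h1]; simp
  have hu : 0 ≤ u := (abs_nonneg _).trans (h ⟨0, hp⟩ ⟨0, hp⟩)
  rw [h1]
  calc |∑ i, ∑ j, v i * v j *
        (∑ t ∈ Finset.Ico p T, ξ (t - (i : ℕ)) * ξ (t - (j : ℕ)) - r * P i j)|
      ≤ ∑ i, ∑ j, |v i| * |v j| * u := by
        refine (Finset.abs_sum_le_sum_abs _ _).trans (Finset.sum_le_sum fun i _ => ?_)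
        refine (Finset.abs_sum_le_sum_abs _ _).trans (Finset.sum_le_sum fun j _ => ?_)
        rw [abs_mul, abs_mul]
        gcongr
        exact h i j
    _ = u * (∑ i, |v i|) ^ 2 := by
        rw [sq, Finset.sum_mul_sum, Finset.mul_sum]
        refine Finset.sum_congr rfl fun i _ => ?_
        rw [Finset.mul_sum]
        exact Finset.sum_congr rfl fun j _ => by ring
    -- Passing from the `ℓ¹` to the `ℓ²` norm of `v` is the source of the factor `p` in the horizon
    -- condition.
    _ ≤ u * (p * ∑ i, |v i| ^ 2) := by
        gcongr
        have := sq_sum_le_card_mul_sum_sq (s := (Finset.univ : Finset (Fin p))) (f := fun i => |v i|)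
        simpa using this
    _ = p * u * ‖v‖ ^ 2 := by
        rw [EuclideanSpace.real_norm_sq_eq]
        simp only [sq_abs]
        ring

end LeastSquares

/-! ### Tail bounds -/

section Tails

open scoped ENNReal

variable {Ω : Type*} [MeasurableSpace Ω] {μ : Measure Ω}

/-- A two-sided Chernoff bound in which `q` may be random, so that it also serves for a compensated
martingale. -/
theorem measure_le_abs_sub_le {X q : Ω → ℝ} (hX : AEMeasurable X μ) (hq : AEMeasurable q μ)
    {K : ℝ} (h1 : expMoment μ (fun ω => X ω - q ω) ≤ ENNReal.ofReal K)
    (h2 : expMoment μ (fun ω => -X ω - q ω) ≤ ENNReal.ofReal K) (u : ℝ) :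
    μ {ω | u ≤ |X ω| - q ω} ≤ ENNReal.ofReal (2 * K * Real.exp (-u)) := by
  have e1 : ENNReal.ofReal (2 * K * Real.exp (-u)) =
      ENNReal.ofReal K * ENNReal.ofReal (Real.exp (-u)) +
        ENNReal.ofReal K * ENNReal.ofReal (Real.exp (-u)) := by
    rw [mul_assoc, ENNReal.ofReal_mul (by norm_num), ENNReal.ofReal_ofNat,
      ENNReal.ofReal_mul' (Real.exp_pos _).le, two_mul]
  rw [e1]
  refine (measure_mono (t := {ω | u ≤ X ω - q ω} ∪ {ω | u ≤ -X ω - q ω}) fun ω hω => ?_).trans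
    ((measure_union_le _ _).trans (add_le_add
      (measure_ge_le_of_expMoment_le (hX.sub hq) h1 u)
      (measure_ge_le_of_expMoment_le (hX.neg.sub hq) h2 u)))
  simp only [Set.mem_ofPred_eq, Set.mem_union] at hω ⊢
  rcases abs_cases (X ω) with h | h
  · left; linarith
  · right; linarith

theorem exp_neg_mul_log {T : ℕ} (hT : 0 < T) (k : ℕ) :
    Real.exp (-(k * Real.log T)) = 1 / (T : ℝ) ^ k := by
  rw [Real.exp_neg, Real.exp_nat_mul, Real.exp_log (by exact_mod_cast hT), one_div]

namespace IsNoise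

variable {v c : ℝ} {e : ℤ → Ω → ℝ} (hn : IsNoise μ v c e)
  {T : ℕ} (hT : 0 < T)

include hn hT

theorem measure_abs_le (t : ℤ) :
    μ {ω | √(26 * c * Real.log T) ≤ |e t ω|} ≤ ENNReal.ofReal (2 * 1 * (1 / (T : ℝ) ^ 13)) := by
  have hc := hn.proxy_pos
  have hlog : 0 ≤ Real.log T := Real.log_natCast_nonneg T
  set u := √(26 * c * Real.log T) with hu
  have hu2 : u ^ 2 = 26 * c * Real.log T := Real.sq_sqrt (by positivity)
  set s : ℝ := u / c with hs
  have hs0 : 0 ≤ s := by positivity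
  have key : ∀ r : ℝ, expMoment μ (fun ω => r * e t ω - c * r ^ 2 / 2) ≤ ENNReal.ofReal 1 :=
    fun r => by
      have h1 : ∀ ω, ENNReal.ofReal (Real.exp (r * e t ω - c * r ^ 2 / 2)) =
          ENNReal.ofReal (Real.exp (-(c * r ^ 2 / 2))) * ENNReal.ofReal (Real.exp (r * e t ω)) :=
        fun ω => by
          rw [← ENNReal.ofReal_mul (Real.exp_pos _).le, ← Real.exp_add]
          congr 2; ring
      unfold expMoment
      simp only [h1]
      rw [lintegral_const_mul' _ _ ENNReal.ofReal_ne_top]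
      refine (mul_le_mul_right (hn.expMoment_le t r) _).trans ?_
      rw [← ENNReal.ofReal_mul (Real.exp_pos _).le, ← Real.exp_add]
      simp
  have h := measure_le_abs_sub_le (X := fun ω => s * e t ω) (q := fun _ => c * s ^ 2 / 2)
    ((hn.measurable t).aemeasurable.const_mul s) aemeasurable_const (key s)
    (by simpa using key (-s)) ((13 : ℕ) * Real.log T)
  rw [exp_neg_mul_log hT] at h
  refine (measure_mono fun ω hω => ?_).trans h
  simp only [Set.mem_ofPred_eq] at hω ⊢
  rw [abs_mul, abs_of_nonneg hs0]
  have e1 : s * u - c * s ^ 2 / 2 = 13 * Real.log T := by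
    have : s * u - c * s ^ 2 / 2 = u ^ 2 / (2 * c) := by rw [hs]; field_simp; ring
    rw [this, hu2]; field_simp; ring
  push_cast
  rw [← e1]
  gcongr

variable [IsProbabilityMeasure μ]

/-- Chernoff at the largest admissible `s = 1 / (16 c √T H²)` with exponent `13 log T`, whence `208
= 13 * 16`. -/
theorem measure_cov_le {g g' : ℕ → ℝ} {X X' : ℤ → Ω → ℝ}
    (hX : IsFiltered μ e g X) (hX' : IsFiltered μ e g' X') {H : ℝ} (hH : 0 < H)
    (hg : ∀ K, ∑ k ∈ Finset.range K, |g k| ≤ H) (hg' : ∀ K, ∑ k ∈ Finset.range K, |g' k| ≤ H)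
    {ρ : ℝ} (hρ : HasSum (fun k => g k * g' k) ρ) (a : ℤ) {n : ℕ} (hnT : n ≤ T) :
    μ {ω | 208 * c * H ^ 2 * (√T * Real.log T) ≤
      |∑ i ∈ Finset.range n, X (a + i) ω * X' (a + i) ω - n * (v * ρ)|} ≤
        ENNReal.ofReal (2 * Real.exp 8 * (1 / (T : ℝ) ^ 13)) := by
  have hc := hn.proxy_pos
  have hT' : 0 < √(T : ℝ) := Real.sqrt_pos.2 (by exact_mod_cast hT)
  set s : ℝ := 1 / (16 * c * √T * H ^ 2) with hs
  have hs0 : 0 < s := by positivity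
  have hsH : s * H ^ 2 = 1 / (16 * c * √T) := by rw [hs]; field_simp
  set Z : Ω → ℝ := fun ω => ∑ i ∈ Finset.range n, X (a + i) ω * X' (a + i) ω - n * (v * ρ) with hZ
  have hm : AEMeasurable Z μ := (Finset.aemeasurable_fun_sum _ fun i _ =>
    (hn.aemeasurable_of_isFiltered hX _).mul (hn.aemeasurable_of_isFiltered hX' _)).sub_const _
  have key : ∀ r : ℝ, |r| = s → expMoment μ (fun ω => r * Z ω) ≤ ENNReal.ofReal (Real.exp 8) :=
    fun r hr => hn.expMoment_filtered_mul_le hX hX' hg hg' hρ a hT hnT (by rw [hr, hsH])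
  have h := measure_le_abs_sub_le (X := fun ω => s * Z ω) (q := fun _ => 0) (hm.const_mul s)
    aemeasurable_const (by simpa using key s (abs_of_pos hs0))
    (by simpa using key (-s) (by rw [abs_neg, abs_of_pos hs0])) ((13 : ℕ) * Real.log T)
  rw [exp_neg_mul_log hT] at h
  refine (measure_mono fun ω hω => ?_).trans h
  simp only [Set.mem_ofPred_eq] at hω ⊢
  rw [sub_zero, abs_mul, abs_of_pos hs0]
  calc ((13 : ℕ) : ℝ) * Real.log T = s * (208 * c * H ^ 2 * (√T * Real.log T)) := by
        rw [hs]; push_cast; field_simp; ring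
    _ ≤ s * |Z ω| := by gcongr

/-- A Freedman-type bound: where the quadratic variation is at most `Q`, the compensator is at most
`c s² Q / 2`, and `s = u / (c Q)` optimizes the exponent to `u² / (2 c Q) = 13 log T`. -/
theorem measure_martingale_le {g : ℕ → ℝ} {X : ℤ → Ω → ℝ} (hX : IsFiltered μ e g X) (a : ℤ)
    (n : ℕ) {Q : ℝ} (hQ : 0 < Q) :
    μ {ω | √(26 * c * Q * Real.log T) ≤ |∑ i ∈ Finset.range n, X (a + i) ω * e (a + 1 + i) ω| ∧
      ∑ i ∈ Finset.range n, X (a + i) ω ^ 2 ≤ Q} ≤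
        ENNReal.ofReal (2 * 1 * (1 / (T : ℝ) ^ 13)) := by
  have hc := hn.proxy_pos
  have hlog : 0 ≤ Real.log T := Real.log_natCast_nonneg T
  set u := √(26 * c * Q * Real.log T) with hu
  have hu2 : u ^ 2 = 26 * c * Q * Real.log T := Real.sq_sqrt (by positivity)
  set s : ℝ := u / (c * Q) with hs
  have hs0 : 0 ≤ s := by positivity
  have hXm := hn.aemeasurable_of_isFiltered hX
  have key : ∀ r : ℝ, expMoment μ (fun ω =>
      r * ∑ i ∈ Finset.range n, X (a + i) ω * e (a + 1 + i) ω -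
        c / 2 * r ^ 2 * ∑ i ∈ Finset.range n, X (a + i) ω ^ 2) ≤ ENNReal.ofReal 1 := fun r => by
    rw [ENNReal.ofReal_one]
    refine le_trans (le_of_eq ?_) (hn.expMoment_filtered_noise_le hX a n r)
    congr 1
    ext ω
    rw [Finset.mul_sum, Finset.mul_sum, ← Finset.sum_sub_distrib]
    exact Finset.sum_congr rfl fun i _ => by ring
  have h := measure_le_abs_sub_le
    (X := fun ω => s * ∑ i ∈ Finset.range n, X (a + i) ω * e (a + 1 + i) ω)
    (q := fun ω => c / 2 * s ^ 2 * ∑ i ∈ Finset.range n, X (a + i) ω ^ 2)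
    ((Finset.aemeasurable_fun_sum _ fun i _ =>
      (hXm _).mul (hn.measurable _).aemeasurable).const_mul s)
    ((Finset.aemeasurable_fun_sum _ fun i _ => (hXm _).pow_const 2).const_mul _)
    (key s) (by simpa using key (-s)) ((13 : ℕ) * Real.log T)
  rw [exp_neg_mul_log hT] at h
  refine (measure_mono fun ω hω => ?_).trans h
  simp only [Set.mem_ofPred_eq] at hω ⊢
  obtain ⟨h1, h2⟩ := hω
  rw [abs_mul, abs_of_nonneg hs0]
  have e1 : s * u - c / 2 * s ^ 2 * Q = 13 * Real.log T := by
    have : s * u - c / 2 * s ^ 2 * Q = u ^ 2 / (2 * c * Q) := by rw [hs]; field_simp; ring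
    rw [this, hu2]; field_simp; ring
  push_cast
  rw [← e1]
  gcongr

end IsNoise

end Tails

/-! ### Consequences of stability and of a large horizon -/

namespace ARFamily

variable {N : ℕ} {M : ARFamily N}

theorem Stable.rootRadius_lt_one (h : M.Stable) (n : Fin N) : rootRadius (M.α n) < 1 := by
  rw [rootRadius, Finset.sup_lt_iff (by simp)]
  intro z hz
  have := (h n).1 z (Multiset.mem_toFinset.1 hz)
  exact_mod_cast this

theorem Stable.lamStar_lt_one (h : M.Stable) : M.lamStar < 1 := by
  have : (Finset.univ.sup fun n => rootRadius (M.α n)) < 1 := by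
    rw [Finset.sup_lt_iff (by simp)]
    exact fun n _ => h.rootRadius_lt_one n
  exact_mod_cast this

theorem rootRadius_le_lamStar (n : Fin N) : (rootRadius (M.α n) : ℝ) ≤ M.lamStar := by
  have : rootRadius (M.α n) ≤ Finset.univ.sup fun n => rootRadius (M.α n) :=
    Finset.le_sup (f := fun n => rootRadius (M.α n)) (Finset.mem_univ n)
  exact_mod_cast this

theorem rootConst_le_cLam (n : Fin N) : rootConst (M.α n) ≤ M.cLam :=
  le_ciSup (f := fun n => rootConst (M.α n)) (Set.finite_range _).bddAbove n

theorem Stable.summable_abs_impulse (h : M.Stable) (n : Fin N) [NeZero (M.p n)] :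
    Summable fun k => |impulse (M.α n) k| :=
  Samossa.summable_abs_impulse _ (h n).2 (h.rootRadius_lt_one n)

/-- The right-hand side is `σ_x / σ`: this is how `σ_x` enters every later estimate. -/
theorem Stable.tsum_abs_impulse_le (h : M.Stable) (n : Fin N) [NeZero (M.p n)] :
    ∑' k, |impulse (M.α n) k| ≤ M.cLam / (1 - M.lamStar) := by
  refine (Samossa.tsum_abs_impulse_le _ (h n).2 (h.rootRadius_lt_one n)).trans ?_
  have h1 := rootConst_nonneg (M.α n)
  have h2 := h.lamStar_lt_one
  exact div_le_div₀ (h1.trans (rootConst_le_cLam n)) (rootConst_le_cLam n) (by linarith)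
    (by linarith [M.rootRadius_le_lamStar n])

theorem sigmaX_eq (σ : ℝ) : M.sigmaX σ = M.cLam / (1 - M.lamStar) * σ := by
  rw [sigmaX]; ring

theorem psiMin_le (n : Fin N) : M.psiMin ≤ lamMin (gramPsi (M.α n)) :=
  ciInf_le (f := fun n => lamMin (gramPsi (M.α n))) (Set.finite_range _).bddBelow n

theorem le_psiMax (n : Fin N) : lamMax (gramPsi (M.α n)) ≤ M.psiMax :=
  le_ciSup (f := fun n => lamMax (gramPsi (M.α n))) (Set.finite_range _).bddAbove n

theorem p_le_pMax (n : Fin N) : M.p n ≤ M.pMax := Finset.le_sup (Finset.mem_univ n)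

/-- The left-hand side of the horizon condition is nonnegative, so its right-hand side is positive.
As `gammaMax` cannot be negative, and division by zero gives zero, the numerator must be positive.
-/
theorem LargeHorizon.psiMin_pos {σ C₀ : ℝ} {T : ℕ} (h : M.LargeHorizon σ C₀ T) (hC₀ : 0 ≤ C₀) :
    0 < M.psiMin := by
  have h0 : 0 ≤ Real.log T / √T := div_nonneg (Real.log_natCast_nonneg T) (Real.sqrt_nonneg _)
  have h1 := h0.trans_lt h
  have h2 : 0 ≤ C₀ * σ ^ 2 / (M.pMax * M.sigmaX σ ^ 2 * max 1 (M.alphaMax ^ 2)) := by positivity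
  have h3 : 0 < M.psiMin / M.gammaMax := (pos_iff_pos_of_mul_pos h1).1 (lt_of_le_of_ne h2 fun h4 => by
    rw [← h4, zero_mul] at h1; exact lt_irrefl _ h1)
  rcases M.gammaMax_eq_zero_or_one_le with h4 | h4
  · rw [h4, div_zero] at h3; exact absurd h3 (lt_irrefl _)
  · exact (div_pos_iff_of_pos_right (by linarith)).1 h3

/-- The horizon requirement without the factors that are at least one. -/
theorem LargeHorizon.log_mul_le {σ C₀ : ℝ} {T : ℕ} (h : M.LargeHorizon σ C₀ T) (hC₀ : 0 < C₀)
    (hσ : 0 < σ) (hT : 0 < T) (hp : 0 < M.pMax) (hH : 0 < M.cLam / (1 - M.lamStar)) :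
    M.pMax * (M.cLam / (1 - M.lamStar)) ^ 2 * (√T * Real.log T) ≤ C₀ * T * M.psiMin := by
  have hψ := h.psiMin_pos hC₀.le
  set H := M.cLam / (1 - M.lamStar) with hHdef
  have hγ : 1 ≤ M.gammaMax := by
    rcases M.gammaMax_eq_zero_or_one_le with h4 | h4
    · have h0 : 0 ≤ Real.log T / √T := div_nonneg (Real.log_natCast_nonneg T) (Real.sqrt_nonneg _)
      have h1 := h0.trans_lt h
      rw [h4, div_zero, mul_zero] at h1
      exact absurd h1 (lt_irrefl _)
    · exact h4
  have hp' : (0 : ℝ) < M.pMax := by exact_mod_cast hp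
  have hT' : (0 : ℝ) < T := by exact_mod_cast hT
  have hsT := Real.sqrt_pos.2 hT'
  have h1 : Real.log T / √T ≤ C₀ / (M.pMax * H ^ 2) * M.psiMin := by
    refine h.le.trans ?_
    have e1 : C₀ / (M.pMax * H ^ 2) = C₀ * σ ^ 2 / (M.pMax * M.sigmaX σ ^ 2 * 1) := by
      rw [sigmaX_eq, ← hHdef]; field_simp
    have hx : 0 < M.sigmaX σ := by rw [sigmaX_eq]; positivity
    rw [e1]
    gcongr
    · exact le_max_left _ _
    · exact div_le_self hψ.le hγ
  rw [div_mul_eq_mul_div, div_le_div_iff₀ hsT (by positivity)] at h1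
  calc M.pMax * H ^ 2 * (√T * Real.log T) = √T * (Real.log T * (M.pMax * H ^ 2)) := by ring
    _ ≤ √T * (C₀ * M.psiMin * √T) := by gcongr
    _ = C₀ * (√T * √T) * M.psiMin := by ring
    _ = C₀ * T * M.psiMin := by rw [Real.mul_self_sqrt hT'.le]

end ARFamily

/-! ### The high probability event -/

section Event

variable {Ω : Type*} [MeasurableSpace Ω] {μ : Measure Ω} [IsProbabilityMeasure μ]

/-- A union bound over `p²` covariance entries, the `p` directions `V k` and the noise variables,
each failing with probability `O(T ^ (-13))`. The set does not depend on any estimate. -/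
theorem exists_exceptional_set {p : ℕ} [NeZero p] {α : EuclideanSpace ℝ (Fin p)} {v c : ℝ}
    {x e : ℤ → Ω → ℝ} (hn : IsNoise μ v c e) (hs : Summable fun k => |impulse α k|)
    (hx : IsFiltered μ e (impulse α) x) {H : ℝ} (hH : ∑' k, |impulse α k| ≤ H) {T : ℕ}
    (hpT : p * p ≤ T) {Q : ℝ} (hQ : 0 < Q) (V : Fin p → EuclideanSpace ℝ (Fin p)) :
    ∃ B : Set Ω, μ B ≤ ENNReal.ofReal (6 * Real.exp 8 / (T : ℝ) ^ 10) ∧ ∀ ω ∉ B,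
      (∀ i j : Fin p, |∑ t ∈ Finset.Ico p T, x ((t - (i : ℕ) : ℕ) : ℤ) ω *
        x ((t - (j : ℕ) : ℕ) : ℤ) ω - (T - p : ℕ) * v * gramPsi α i j| ≤
          208 * c * H ^ 2 * (√T * Real.log T)) ∧
      (∀ k, ∑ t ∈ Finset.Ico p T, (∑ i : Fin p, V k i * x ((t - (i : ℕ) : ℕ) : ℤ) ω) ^ 2 ≤ Q →
        |∑ t ∈ Finset.Ico p T, (∑ i : Fin p, V k i * x ((t - (i : ℕ) : ℕ) : ℤ) ω) *
          e ((t + 1 : ℕ) : ℤ) ω| ≤ √(26 * c * Q * Real.log T)) ∧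
      ∀ t ∈ Finset.Ico p T, |e ((t + 1 : ℕ) : ℤ) ω| ≤ √(26 * c * Real.log T) := by
  have hp : 0 < p := NeZero.pos p
  have hpT' : p ≤ T := le_trans (Nat.le_mul_of_pos_left p hp) hpT
  have hT : 0 < T := lt_of_lt_of_le hp hpT'
  have hTr : (1 : ℝ) ≤ T := by exact_mod_cast hT
  have hH0 : 0 < H := lt_of_lt_of_le one_pos (one_le_of_tsum_abs_impulse_le α hs hH)
  have hf := isFiltered_stateImpulse α hx
  have hsum : ∀ (i : Fin p) K, ∑ k ∈ Finset.range K, |stateImpulse α i k| ≤ H := fun i K =>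
    (sum_range_abs_stateImpulse_le α hs i K).trans hH
  have hidx : ∀ (k : ℕ) (i : Fin p), ((p : ℤ) + k - (i : ℕ)) = ((p + k - (i : ℕ) : ℕ) : ℤ) :=
    fun k i => by have := i.2; omega
  have hidx' : ∀ k : ℕ, ((p : ℤ) + 1 + k) = ((p + k + 1 : ℕ) : ℤ) := fun k => by push_cast; ring
  set β := ENNReal.ofReal (2 * Real.exp 8 * (1 / (T : ℝ) ^ 13)) with hβ
  have hβ1 : ENNReal.ofReal (2 * 1 * (1 / (T : ℝ) ^ 13)) ≤ β := by
    refine ENNReal.ofReal_le_ofReal ?_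
    gcongr
    exact Real.one_le_exp (by norm_num)
  set B1 : Fin p × Fin p → Set Ω := fun q => {ω | 208 * c * H ^ 2 * (√T * Real.log T) ≤
    |∑ k ∈ Finset.range (T - p), x (p + k - (q.1 : ℕ)) ω * x (p + k - (q.2 : ℕ)) ω -
      (T - p : ℕ) * (v * gramPsi α q.1 q.2)|} with hB1
  set B2 : Fin p → Set Ω := fun l => {ω | √(26 * c * Q * Real.log T) ≤
    |∑ k ∈ Finset.range (T - p), (∑ i : Fin p, V l i * x (p + k - (i : ℕ)) ω) *
      e (p + 1 + k) ω| ∧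
    ∑ k ∈ Finset.range (T - p), (∑ i : Fin p, V l i * x (p + k - (i : ℕ)) ω) ^ 2 ≤ Q} with hB2
  set B3 : ℕ → Set Ω := fun k => {ω | √(26 * c * Real.log T) ≤ |e (p + 1 + k) ω|} with hB3
  have m1 : ∀ q, μ (B1 q) ≤ β := fun q =>
    hn.measure_cov_le hT (hf q.1) (hf q.2) hH0 (hsum q.1) (hsum q.2) (hasSum_gramPsi α hs q.1 q.2)
      p (Nat.sub_le T p)
  have m2 : ∀ l, μ (B2 l) ≤ β := fun l =>
    (hn.measure_martingale_le hT (IsFiltered.sum hf (V l)) p (T - p) hQ).trans hβ1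
  have m3 : ∀ k, μ (B3 k) ≤ β := fun k => (hn.measure_abs_le hT _).trans hβ1
  refine ⟨(⋃ q, B1 q) ∪ (⋃ l, B2 l) ∪ ⋃ k ∈ Finset.range T, B3 k, ?_, ?_⟩
  · calc μ ((⋃ q, B1 q) ∪ (⋃ l, B2 l) ∪ ⋃ k ∈ Finset.range T, B3 k)
        ≤ (∑ q, μ (B1 q) + ∑ l, μ (B2 l)) + ∑ k ∈ Finset.range T, μ (B3 k) :=
          (measure_union_le _ _).trans (add_le_add ((measure_union_le _ _).trans
            (add_le_add (measure_iUnion_fintype_le _ _) (measure_iUnion_fintype_le _ _)))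
            (measure_biUnion_finset_le _ _))
      _ ≤ (∑ _q : Fin p × Fin p, β + ∑ _l : Fin p, β) + ∑ _k ∈ Finset.range T, β := by
          gcongr with q _ l _ k _
          · exact m1 q
          · exact m2 l
          · exact m3 k
      _ = ((p * p + p + T : ℕ) : ENNReal) * β := by
          simp only [Finset.sum_const, Finset.card_univ, Fintype.card_prod, Fintype.card_fin,
            Finset.card_range, nsmul_eq_mul]
          push_cast
          ring
      -- Since `p * p ≤ T`, there are at most `3 T` events.
      _ ≤ ((3 * T : ℕ) : ENNReal) * β := by
          gcongr
          omega
      _ ≤ ENNReal.ofReal (6 * Real.exp 8 / (T : ℝ) ^ 10) := by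
          rw [hβ, ← ENNReal.ofReal_natCast, ← ENNReal.ofReal_mul (by positivity)]
          refine ENNReal.ofReal_le_ofReal ?_
          push_cast
          have h1 : 3 * (T : ℝ) * (2 * Real.exp 8 * (1 / (T : ℝ) ^ 13)) =
              6 * Real.exp 8 / (T : ℝ) ^ 12 := by
            field_simp; ring
          rw [h1]
          gcongr
          norm_num
  · intro ω hω
    simp only [Set.mem_union, Set.mem_iUnion, not_or, not_exists] at hω
    obtain ⟨⟨h1, h2⟩, h3⟩ := hω
    refine ⟨fun i j => ?_, fun k hk => ?_, fun t ht => ?_⟩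
    · have := h1 (i, j)
      simp only [hB1, Set.mem_ofPred_eq, not_le, hidx] at this
      rw [Finset.sum_Ico_eq_sum_range, mul_assoc ((T - p : ℕ) : ℝ)]
      exact this.le
    · have := h2 k
      simp only [hB2, Set.mem_ofPred_eq, not_and, hidx, hidx'] at this
      rw [Finset.sum_Ico_eq_sum_range] at hk ⊢
      by_contra hcon
      exact this (not_le.1 hcon).le hk
    · have ht' := Finset.mem_Ico.1 ht
      have := h3 (t - p) (Finset.mem_range.2 (by omega))
      simp only [hB3, Set.mem_ofPred_eq, not_le, hidx'] at this
      rw [Nat.add_sub_cancel' ht'.1] at this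
      exact this.le

end Event

/-- The exceptional set is only bounded in outer measure, so the complement of its measurable hull
serves as the event. -/
theorem exists_measurableSet_of_exceptional {Ω : Type*} [MeasurableSpace Ω] {μ : Measure Ω}
    [IsProbabilityMeasure μ] {B : Set Ω} {b : ℝ} (hb : 0 ≤ b) (hB : μ B ≤ ENNReal.ofReal b) :
    ∃ S : Set Ω, MeasurableSet S ∧ 1 - b ≤ μ.real S ∧ ∀ ω ∈ S, ω ∉ B := by
  refine ⟨(toMeasurable μ B)ᶜ, (measurableSet_toMeasurable _ _).compl, ?_, fun ω hω h =>
    hω (subset_toMeasurable _ _ h)⟩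
  rw [probReal_compl_eq_one_sub (measurableSet_toMeasurable _ _)]
  have : μ.real (toMeasurable μ B) ≤ b := by
    rw [measureReal_def, measure_toMeasurable]
    exact ENNReal.toReal_le_of_le_ofReal hb hB
  linarith

/-! ### The estimation error -/

namespace ARFamily

/-- The bound for the least squares estimate, with the values of the noise level and of the
martingale term on the high probability event. -/
theorem le_identBound {N : ℕ} {M : ARFamily N} {σ κ T L E a : ℝ} {q : ℕ}
    (hq : 0 < q) (hqM : q ≤ M.pMax) (hσ : 0 < σ) (hκ : 1 ≤ κ) (hT : 0 < T) (hL : 1 ≤ L)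
    (hE : 0 ≤ E) (hH1 : 1 ≤ (M.cLam / (1 - M.lamStar)) ^ 2) (hψ : 0 < M.psiMin) (hψH : M.psiMin ≤ (M.cLam / (1 - M.lamStar)) ^ 2)
    (haH : M.psiMin * a ^ 2 ≤ (M.cLam / (1 - M.lamStar)) ^ 2) :
    1000000 / (T * σ ^ 2 * M.psiMin) *
      (q * (52 * κ * T * σ ^ 4 * L) / (T * σ ^ 2) +
        q * (T * E) * (T * (26 * κ * σ ^ 2 * L)) / (T * σ ^ 2 * M.psiMin) +
        (a ^ 2 * q + 1) * (T * E)) ≤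
      100000000 * κ * M.pMax / M.psiMin * (M.pMax / T * L +
        M.sigmaX σ ^ 2 * E * L / (σ ^ 2 * min 1 (σ ^ 2 * M.psiMin))) := by
  set ψ := M.psiMin with hψdef
  set H := M.cLam / (1 - M.lamStar) with hH
  obtain ⟨P, hP⟩ : ∃ P : ℝ, P = (M.pMax : ℝ) := ⟨_, rfl⟩
  have hqP : (q : ℝ) ≤ P := by rw [hP]; exact_mod_cast hqM
  have hq1 : (1 : ℝ) ≤ q := by exact_mod_cast hq
  have hP1 : 1 ≤ P := hq1.trans hqP
  rw [M.sigmaX_eq, ← hH, ← hP]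
  -- Both perturbation terms are multiples of `Z` at most, by `1 ≤ H²`, `ψ a² ≤ H²`, `ψ ≤ H²` and `1
  -- ≤ L`.
  set Z := P * (H ^ 2 * (E * L)) / (σ ^ 2 * ψ ^ 2) with hZ
  have e1 : 1000000 / (T * σ ^ 2 * ψ) * (q * (52 * κ * T * σ ^ 4 * L) / (T * σ ^ 2) +
        q * (T * E) * (T * (26 * κ * σ ^ 2 * L)) / (T * σ ^ 2 * ψ) + (a ^ 2 * q + 1) * (T * E)) =
      52000000 * κ * (q * L / (T * ψ)) + 26000000 * κ * (q * (1 * (E * L)) / (σ ^ 2 * ψ ^ 2)) +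
        1000000 * ((q * ((ψ * a ^ 2) * E) + ψ * E) / (σ ^ 2 * ψ ^ 2)) := by
    field_simp
    ring
  have hEL : E ≤ E * L := le_mul_of_one_le_right hE hL
  have b1 : q * L / (T * ψ) ≤ P / ψ * (P / T * L) := by
    calc q * L / (T * ψ) ≤ (P * P) * L / (T * ψ) := by
          gcongr
          nlinarith
      _ = P / ψ * (P / T * L) := by field_simp
  have b2 : q * (1 * (E * L)) / (σ ^ 2 * ψ ^ 2) ≤ Z := by rw [hZ]; gcongr
  have b3 : (q * ((ψ * a ^ 2) * E) + ψ * E) / (σ ^ 2 * ψ ^ 2) ≤ 2 * Z := by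
    have h1 : q * ((ψ * a ^ 2) * E) ≤ P * (H ^ 2 * (E * L)) := by gcongr
    have h2 : ψ * E ≤ P * (H ^ 2 * (E * L)) := by
      calc ψ * E ≤ 1 * (H ^ 2 * (E * L)) := by rw [one_mul]; gcongr
        _ ≤ _ := by gcongr
    rw [hZ, mul_div_assoc', two_mul]
    gcongr
  have b4 : Z ≤ P / ψ * ((H * σ) ^ 2 * E * L / (σ ^ 2 * min 1 (σ ^ 2 * ψ))) := by
    have hmin : 0 < min 1 (σ ^ 2 * ψ) := lt_min one_pos (by positivity)
    calc Z = P / ψ * ((H * σ) ^ 2 * E * L / (σ ^ 2 * (σ ^ 2 * ψ))) := by rw [hZ]; field_simp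
      _ ≤ _ := by
          gcongr
          exact min_le_right _ _
  have hZ0 : 0 ≤ Z := by positivity
  have hb0 : 0 ≤ P / ψ * (P / T * L) := by positivity
  have hκ0 : 0 < κ := by linarith
  rw [e1]
  calc 52000000 * κ * (q * L / (T * ψ)) + 26000000 * κ * (q * (1 * (E * L)) / (σ ^ 2 * ψ ^ 2)) +
        1000000 * ((q * ((ψ * a ^ 2) * E) + ψ * E) / (σ ^ 2 * ψ ^ 2))
      ≤ 52000000 * κ * (P / ψ * (P / T * L)) + 26000000 * κ * Z + 1000000 * (2 * Z) := by gcongr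
    _ ≤ 100000000 * κ * (P / ψ * (P / T * L) + Z) := by nlinarith
    _ ≤ 100000000 * κ * (P / ψ * (P / T * L) +
          P / ψ * ((H * σ) ^ 2 * E * L / (σ ^ 2 * min 1 (σ ^ 2 * ψ)))) := by gcongr
    _ = _ := by ring

end ARFamily

/-- Least squares on a perturbed autoregressive trajectory, for a large horizon: outside of a small
event the bound holds for all admissible perturbations. -/
theorem exists_exceptional_set_ols {Ω : Type*} [MeasurableSpace Ω] {μ : Measure Ω}
    [IsProbabilityMeasure μ] {N T : ℕ} {M : ARFamily N} {σ κ : ℝ} {η x : Fin N → ℤ → Ω → ℝ}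
    (hκ : 1 ≤ κ) (hσ : 0 < σ) (hT : 3 ≤ T) (hM : M.Stable) (hx : M.IsStationaryAR σ κ μ η x)
    (hlarge : M.LargeHorizon σ (1 / (1000 * κ)) T) (n : Fin N) :
    ∃ B : Set Ω, μ B ≤ ENNReal.ofReal (6 * Real.exp 8 / (T : ℝ) ^ 10) ∧ ∀ ω ∉ B,
      ∀ fhat f : ℕ → ℝ, estErr T fhat f ≤ M.errLevel σ →
        ∀ a : EuclideanSpace ℝ (Fin (M.p n)), IsOLS T (fun t => f t + x n t ω - fhat t) a →
          ‖a - M.α n‖ ^ 2 ≤ M.identBound σ (100000000 * κ) T (estErr T fhat f) := by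
  have : NeZero (M.p n) := ⟨(M.p_pos n).ne'⟩
  set p := M.p n with hp
  set α := M.α n with hα
  set H := M.cLam / (1 - M.lamStar) with hHdef
  set ψ := M.psiMin with hψdef
  set Ψ := gramPsi α with hΨ
  have hκ0 : 0 < κ := by linarith
  have hp0 : 0 < p := M.p_pos n
  have hT0 : (0 : ℝ) < T := by exact_mod_cast (by omega : 0 < T)
  have hL : 1 ≤ Real.log T := by
    rw [Real.le_log_iff_exp_le hT0]
    have h3 : (3 : ℝ) ≤ T := by exact_mod_cast hT
    linarith [Real.exp_one_lt_d9]
  have hs := hM.summable_abs_impulse n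
  have hH := hM.tsum_abs_impulse_le n
  have hH1 : 1 ≤ H := one_le_of_tsum_abs_impulse_le α hs hH
  have hψ : 0 < ψ := hlarge.psiMin_pos (by positivity)
  have hherm := gramPsi_isHermitian α hs
  have hform : ∀ v : EuclideanSpace ℝ (Fin p), ψ * ‖v‖ ^ 2 ≤ (v : Fin p → ℝ) ⬝ᵥ Ψ.mulVec v :=
    fun v => le_trans (by gcongr; exact M.psiMin_le n) (lamMin_mul_norm_sq_le hherm v)
  have hψH := le_sq_of_le_gramPsi_form α hs hH hform
  have hαH := mul_norm_sq_le_sq_of_le_gramPsi_form α hs hH hform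
  have hpM : p ≤ M.pMax := M.p_le_pMax n
  have hpMr : (p : ℝ) ≤ M.pMax := by exact_mod_cast hpM
  have hkey : 1000 * κ * (p * H ^ 2 * (√T * Real.log T)) ≤ T * ψ := by
    have h1 := hlarge.log_mul_le (by positivity) hσ (by omega) (hp0.trans_le hpM)
      (by rw [← hHdef]; linarith)
    rw [← hHdef] at h1
    calc 1000 * κ * (p * H ^ 2 * (√T * Real.log T))
        ≤ 1000 * κ * (M.pMax * H ^ 2 * (√T * Real.log T)) := by gcongr
      _ ≤ 1000 * κ * (1 / (1000 * κ) * T * ψ) := by gcongr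
      _ = T * ψ := by field_simp
  -- Combining the horizon condition with `ψ ≤ H²` forces `p` to be small; this yields both `p² ≤ T`
  -- and `T - p ≥ T / 2`.
  have hpsqrt : 2 * (p : ℝ) ≤ √T := by
    have hH2 : 0 < H ^ 2 := by positivity
    have hsT : 0 < √(T : ℝ) := Real.sqrt_pos.2 hT0
    have h1 : (2 * p * √T) * H ^ 2 ≤ T * H ^ 2 := by
      calc (2 * p * √T) * H ^ 2 = 2 * 1 * (p * H ^ 2 * (√T * 1)) := by ring
        _ ≤ 1000 * κ * (p * H ^ 2 * (√T * Real.log T)) := by gcongr; norm_num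
        _ ≤ T * ψ := hkey
        _ ≤ T * H ^ 2 := by gcongr
    have h2 := le_of_mul_le_mul_right h1 hH2
    rw [← Real.mul_self_sqrt hT0.le] at h2
    exact le_of_mul_le_mul_right (by simpa [Real.sqrt_mul_self hsT.le] using h2) hsT
  have hpp : p * p ≤ T := by
    have h1 : (p : ℝ) * p ≤ T := by
      rw [← Real.mul_self_sqrt hT0.le]
      gcongr <;> linarith [(Nat.cast_nonneg p : (0 : ℝ) ≤ p)]
    exact_mod_cast h1
  have hpT : p ≤ T := le_trans (Nat.le_mul_of_pos_left p hp0) hpp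
  have hphalf : (T : ℝ) / 2 ≤ ((T - p : ℕ) : ℝ) := by
    rw [Nat.cast_sub hpT]
    have h1 : √(T : ℝ) ≤ T := Real.sqrt_le_iff.2 ⟨hT0.le, by
      have : (1 : ℝ) ≤ T := by exact_mod_cast (by omega : 1 ≤ T)
      nlinarith⟩
    linarith
  obtain ⟨V, hV1, hV2⟩ := exists_whitening hherm (hψ.trans_le (M.psiMin_le n))
  -- In a direction of unit `Ψ`-norm the quadratic variation has mean `(T - p) σ²` and deviates by
  -- at most `T σ² / 4`, so `Q = 2 T σ²` suffices.
  obtain ⟨B, hB, hgood⟩ := exists_exceptional_set (hx.isNoise hσ hκ n) hs (hx.isFiltered n hs) hH hpp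
    (Q := 2 * T * σ ^ 2) (by positivity) V
  have hrec0 : μ {ω | ¬ ∀ t, x n t ω = ∑ i : Fin p, α i * x n (t - ((i : ℕ) + 1)) ω + η n t ω} = 0 :=
    ae_all_iff.2 (hx.recursion n)
  refine ⟨B ∪ {ω | ¬ ∀ t, x n t ω = ∑ i : Fin p, α i * x n (t - ((i : ℕ) + 1)) ω + η n t ω},
    (measure_union_le _ _).trans (by rw [hrec0, add_zero]; exact hB), fun ω hω fhat f hE a ha => ?_⟩
  rw [Set.mem_union, not_or] at hω
  obtain ⟨h1, h2, h3⟩ := hgood ω hω.1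
  have hrec : ∀ t, x n t ω = ∑ i : Fin p, α i * x n (t - ((i : ℕ) + 1)) ω + η n t ω :=
    not_not.1 hω.2
  set ξ : ℕ → ℝ := fun t => x n t ω with hξ
  set ε : ℕ → ℝ := fun t => η n t ω with hε
  set δ : ℕ → ℝ := fun t => fhat t - f t with hδ
  -- The constant `1 / (1000 κ)` in the horizon condition is chosen so that `208 / 1000 ≤ 1 / 4`.
  -- With `T - p ≥ T / 2`, half of the expected Gram matrix still survives.
  have hclose : ∀ v : EuclideanSpace ℝ (Fin p),
      |∑ t ∈ Finset.Ico p T, (∑ i : Fin p, v i * ξ (t - (i : ℕ))) ^ 2 -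
        (T - p : ℕ) * σ ^ 2 * ((v : Fin p → ℝ) ⬝ᵥ Ψ.mulVec v)| ≤
          T * σ ^ 2 / 4 * ((v : Fin p → ℝ) ⬝ᵥ Ψ.mulVec v) := fun v => by
    refine (abs_sum_sq_sub_le (P := Ψ) h1 v).trans ?_
    calc p * (208 * (κ * σ ^ 2) * H ^ 2 * (√T * Real.log T)) * ‖v‖ ^ 2
        = 208 / 1000 * (1000 * κ * (p * H ^ 2 * (√T * Real.log T)) * (σ ^ 2 * ‖v‖ ^ 2)) := by ring
      _ ≤ 208 / 1000 * (T * ψ * (σ ^ 2 * ‖v‖ ^ 2)) := by gcongr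
      _ ≤ 1 / 4 * (T * ψ * (σ ^ 2 * ‖v‖ ^ 2)) :=
          mul_le_mul_of_nonneg_right (by norm_num) (by positivity)
      _ = T * σ ^ 2 / 4 * (ψ * ‖v‖ ^ 2) := by ring
      _ ≤ _ := by gcongr; exact hform v
  have hq0 : ∀ v : EuclideanSpace ℝ (Fin p), 0 ≤ (v : Fin p → ℝ) ⬝ᵥ Ψ.mulVec v := fun v =>
    le_trans (by positivity) (hform v)
  have hlow : ∀ v : EuclideanSpace ℝ (Fin p), T * σ ^ 2 / 4 * ((v : Fin p → ℝ) ⬝ᵥ Ψ.mulVec v) ≤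
      ∑ t ∈ Finset.Ico p T, (∑ i : Fin p, v i * ξ (t - (i : ℕ))) ^ 2 := fun v => by
    have e1 := (abs_le.1 (hclose v)).1
    have e2 : T / 2 * σ ^ 2 * ((v : Fin p → ℝ) ⬝ᵥ Ψ.mulVec v) ≤
        (T - p : ℕ) * σ ^ 2 * ((v : Fin p → ℝ) ⬝ᵥ Ψ.mulVec v) := by
      have := hq0 v
      gcongr
    linarith
  have hmartV : ∀ k, (∑ t ∈ Finset.Ico p T, (∑ i : Fin p, V k i * ξ (t - (i : ℕ))) * ε (t + 1)) ^ 2 ≤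
      52 * κ * T * σ ^ 4 * Real.log T := fun k => by
    have e1 := (abs_le.1 (hclose (V k))).2
    rw [hV1 k] at e1
    have e2 : ((T - p : ℕ) : ℝ) * σ ^ 2 ≤ T * σ ^ 2 := by
      gcongr; exact Nat.sub_le T p
    have e3 := h2 k (by nlinarith [mul_pos hT0 (pow_pos hσ 2)])
    have e4 := sq_le_sq.2 (e3.trans (le_abs_self _))
    refine e4.trans (le_of_eq ?_)
    rw [Real.sq_sqrt (by positivity)]
    ring
  have hmart : ∀ v : EuclideanSpace ℝ (Fin p),
      ∑ t ∈ Finset.Ico p T, (∑ i : Fin p, v i * ξ (t - (i : ℕ))) * ε (t + 1) ≤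
        √((v : Fin p → ℝ) ⬝ᵥ Ψ.mulVec v) * √(p * (52 * κ * T * σ ^ 4 * Real.log T)) := fun v => by
    have e1 : ∀ u : EuclideanSpace ℝ (Fin p),
        ∑ t ∈ Finset.Ico p T, (∑ i : Fin p, u i * ξ (t - (i : ℕ))) * ε (t + 1) =
          inner ℝ u (WithLp.toLp 2 fun i : Fin p =>
            ∑ t ∈ Finset.Ico p T, ξ (t - (i : ℕ)) * ε (t + 1)) := fun u => by
      simp only [PiLp.inner_apply, RCLike.inner_apply, conj_trivial, Finset.sum_mul]
      rw [Finset.sum_comm]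
      exact Finset.sum_congr rfl fun i _ => Finset.sum_congr rfl fun t _ => by ring
    rw [e1]
    refine (hV2 v _).trans ?_
    gcongr
    refine (Finset.sum_le_card_nsmul _ _ (52 * κ * T * σ ^ 4 * Real.log T) fun k _ => ?_).trans
      (by simp [hp])
    rw [← e1]
    exact hmartV k
  have hB' : ∑ t ∈ Finset.Ico p T, ε (t + 1) ^ 2 ≤ T * (26 * κ * σ ^ 2 * Real.log T) := by
    refine (Finset.sum_le_card_nsmul _ _ (26 * κ * σ ^ 2 * Real.log T) fun t ht => ?_).trans ?_
    · refine (sq_le_sq.2 ((h3 t ht).trans (le_abs_self _))).trans (le_of_eq ?_)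
      rw [Real.sq_sqrt (by positivity)]
      ring
    · rw [Nat.card_Ico, nsmul_eq_mul]
      gcongr
      exact Nat.sub_le T p
  have hS : ∑ t ∈ Finset.Icc 1 T, δ t ^ 2 = T * estErr T fhat f := by
    rw [estErr]; field_simp; rfl
  have hE0 : 0 ≤ estErr T fhat f := by
    rw [estErr]
    exact mul_nonneg (by positivity) (Finset.sum_nonneg fun _ _ => sq_nonneg _)
  have hδ' : p * ∑ t ∈ Finset.Icc 1 T, δ t ^ 2 ≤ T * σ ^ 2 * ψ / 6 := by
    rw [hS]
    have hP0 : (0 : ℝ) < M.pMax := lt_of_lt_of_le (by exact_mod_cast hp0) hpMr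
    calc p * (T * estErr T fhat f) ≤ M.pMax * (T * (σ ^ 2 * ψ / (6 * M.pMax))) := by
          gcongr
          exact hE
      _ = T * σ ^ 2 * ψ / 6 := by field_simp
  have hmain := norm_sub_sq_le_of_isOLS (α := α) (a := a) (ξ := ξ) (ε := ε) (δ := δ)
    (z := fun t => f t + x n t ω - fhat t) (P := Ψ) (m := T * σ ^ 2) (ψ := ψ)
    (A := p * (52 * κ * T * σ ^ 4 * Real.log T)) (B := T * (26 * κ * σ ^ 2 * Real.log T))
    (fun t => by simp only [hξ, hδ]; ring)
    (fun t ht => by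
      have hpt := (Finset.mem_Ico.1 ht).1
      have e1 := hrec ((t + 1 : ℕ) : ℤ)
      simp only [hξ, hε]
      rw [e1]
      congr 1
      refine Finset.sum_congr rfl fun i _ => ?_
      have hi := i.2
      congr 2
      omega)
    (by positivity) hψ hform hlow hmart (by positivity) hB' hδ' ha
  rw [hS] at hmain
  have hbound := ARFamily.le_identBound (M := M) (E := estErr T fhat f) (a := ‖α‖) hp0 hpM hσ hκ hT0
    hL hE0 (one_le_pow₀ hH1) hψ hψH hαH
  refine (hmain.trans hbound).trans ?_
  rw [ARFamily.identBound]
  -- The argument gives `log T`; the logarithm in the statement is larger because `psiMin ≤ psiMax`.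
  have hlog : Real.log T ≤ Real.log (T * M.psiMax / M.psiMin) := by
    refine Real.log_le_log hT0 ?_
    rw [le_div_iff₀ hψ]
    gcongr
    exact (M.psiMin_le n).trans ((lamMin_le_lamMax hherm).trans (M.le_psiMax n))
  gcongr

end Samossa

open Samossa
/-- Here `κ ≥ 1` bounds the ratio of the variance proxy of the noise to its variance `σ²`. The first
part is about the estimates produced by thresholding the stacked Page matrix; in the second part the
perturbation of the autoregressive trajectory is arbitrary. -/
theorem theorem2 (κ : ℝ) (hκ : 1 ≤ κ) :
    ∃ c C₀ C : ℝ, 0 < c ∧ 0 < C₀ ∧ 0 < C ∧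
      ∀ (Ω : Type*) [MeasurableSpace Ω] (μ : Measure Ω) [IsProbabilityMeasure μ]
        (N T : ℕ) (M : ARFamily N) (σ : ℝ) (η x : Fin N → ℤ → Ω → ℝ) (f : Fin N → ℕ → ℝ),
        0 < N → 0 < T → 0 < σ → M.Stable → M.IsStationaryAR σ κ μ η x →
        M.LargeHorizon σ C₀ T →
        ∀ n : Fin N,
          (∀ (L R G : ℕ) (γ : ℝ), FactorModel f L T R G γ →
            ∃ S : Set Ω, MeasurableSet S ∧ 1 - c / (T : ℝ) ^ 10 ≤ μ.real S ∧
              ∀ ω ∈ S, ∀ fhat : Fin N → ℕ → ℝ,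
                IsSamossaEstimate L T (stackedPage f L T 1).rank
                  (fun m t => f m t + x m t ω) fhat →
                estErr T (fhat n) (f n) ≤ M.errLevel σ →
                ∀ a : EuclideanSpace ℝ (Fin (M.p n)),
                  IsOLS T (fun t => f n t + x n t ω - fhat n t) a →
                  ‖a - M.α n‖ ^ 2 ≤ M.identBound σ C T (estErr T (fhat n) (f n))) ∧
          (∃ S : Set Ω, MeasurableSet S ∧ 1 - c / (T : ℝ) ^ 10 ≤ μ.real S ∧
            ∀ ω ∈ S, ∀ fhat : ℕ → ℝ,
              estErr T fhat (f n) ≤ M.errLevel σ →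
              ∀ a : EuclideanSpace ℝ (Fin (M.p n)),
                IsOLS T (fun t => f n t + x n t ω - fhat t) a →
                ‖a - M.α n‖ ^ 2 ≤ M.identBound σ C T (estErr T fhat (f n))) := by

  have hκ0 : 0 < κ := by linarith
  -- The summand `1024 = 2 ^ 10` makes the probability claim vacuous for `T ≤ 2`; for `T ≥ 3` one
  -- has `1 ≤ log T`.
  refine ⟨6 * Real.exp 8 + 1024, 1 / (1000 * κ), 100000000 * κ, by positivity, by positivity,
    by positivity, ?_⟩
  intro Ω _ μ _ N T M σ η x f _ hT hσ hM hx hlarge n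
  have key : ∃ S : Set Ω, MeasurableSet S ∧ 1 - (6 * Real.exp 8 + 1024) / (T : ℝ) ^ 10 ≤ μ.real S ∧
      ∀ ω ∈ S, ∀ fhat : ℕ → ℝ, estErr T fhat (f n) ≤ M.errLevel σ →
        ∀ a : EuclideanSpace ℝ (Fin (M.p n)), IsOLS T (fun t => f n t + x n t ω - fhat t) a →
          ‖a - M.α n‖ ^ 2 ≤ M.identBound σ (100000000 * κ) T (estErr T fhat (f n)) := by
    rcases Nat.lt_or_ge T 3 with hT3 | hT3
    · refine ⟨∅, MeasurableSet.empty, ?_, by simp⟩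
      rw [measureReal_empty, sub_nonpos, one_le_div (by positivity)]
      have h1 : (T : ℝ) ^ 10 ≤ 2 ^ 10 := by
        gcongr
        exact_mod_cast (by omega : T ≤ 2)
      have := Real.exp_pos 8
      linarith
    · obtain ⟨B, hB, hgood⟩ := exists_exceptional_set_ols hκ hσ hT3 hM hx hlarge n
      obtain ⟨S, hS, hμS, hSB⟩ := exists_measurableSet_of_exceptional (by positivity) hB
      refine ⟨S, hS, le_trans ?_ hμS, fun ω hω fhat => hgood ω (hSB ω hω) fhat (f n)⟩
      gcongr
      linarith
  obtain ⟨S, hS, hμS, hgood⟩ := key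
  exact ⟨fun L R G γ _ => ⟨S, hS, hμS, fun ω hω fhat _ => hgood ω hω (fhat n)⟩, S, hS, hμS, hgood⟩
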